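/- Let $X$ be a compact complex surface (a compact Hausdorff complex manifold of complex dimension $2$, without boundary) with complex structure $J$, and let $g$ be a smooth Hermitian metric on $X$ with fundamental form $\omega(x,y)=g(x,Jy)$. Let $\nabla^B$ be the Bismut connection of $g$, that is, the unique affine connection with $\nabla^B g=0$, $\nabla^B J=0$ and totally skew-symmetric torsion $T(x,y,z)=g(T(x,y),z)$, and let $$R^B(x,y)z=\nabla^B_x\nabla^B_y z-\nabla^B_y\nabla^B_x z-\nabla^B_{[x,y]}z,\qquad R^B(x,y,z,w)=g(R^B(x,y)z,w).$$ Suppose that $$R^B(x,y,z,w)=R^B(Jx,Jy,z,w)$$ for all tangent vectors $x,y,z,w$. Then the Lee form $\theta$ of $g$, i.e. the unique $1$-form with $d\omega=\theta\wedge\omega$, satisfies $d\theta=0$. In particular $g$ is locally conformally Kähler, that is, $d\omega=\alpha\wedge\omega$ for some closed $1$-form $\alpha$. -/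

import Mathlib

open scoped Manifold ContDiff Bundle
open VectorField

noncomputable section

namespace BismutSurface

/-- A complex manifold modelled on the complex normed space `E` is in particular a real manifold
modelled on the underlying real normed space. -/
instance isManifold_real {E : Type*} [NormedAddCommGroup E] [NormedSpace ℂ E]
    {X : Type*} [TopologicalSpace X] [ChartedSpace E X] [IsManifold 𝓘(ℂ, E) ω X] :
    IsManifold 𝓘(ℝ, E) ω X := by
  refine isManifold_of_contDiffOn 𝓘(ℝ, E) ω X fun e e' he he' => ?_
  have h := (contDiffGroupoid ω 𝓘(ℂ, E)).compatible he he'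
  rw [contDiffGroupoid, mem_groupoid_of_pregroupoid] at h
  exact ContDiffOn.restrict_scalars ℝ h.1

variable {E : Type*} [NormedAddCommGroup E] [NormedSpace ℂ E] [FiniteDimensional ℂ E]
  {X : Type*} [TopologicalSpace X] [ChartedSpace E X] [IsManifold 𝓘(ℂ, E) ω X]

/-- The complex structure `J` on the real tangent space at `x`: multiplication by `i`. Mathlib
identifies the tangent space at `x` with `E` through the preferred holomorphic chart at `x`; the
transition maps between charts have complex linear derivatives, so `J` does not depend on the
chart. -/
def J (x : X) : TangentSpace 𝓘(ℝ, E) x →L[ℝ] TangentSpace 𝓘(ℝ, E) x :=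
  show E →L[ℝ] E from (Complex.I • ContinuousLinearMap.id ℂ E).restrictScalars ℝ

variable (E X) in
/-- A (smooth) Hermitian metric on a complex manifold: a smooth Riemannian metric `g` with
`g(Jx, Jy) = g(x, y)`. -/
structure HermitianMetric extends
    Bundle.ContMDiffRiemannianMetric 𝓘(ℝ, E) ∞ E (fun x : X => TangentSpace 𝓘(ℝ, E) x) where
  inner_J (x : X) (u v : TangentSpace 𝓘(ℝ, E) x) : inner x (J x u) (J x v) = inner x u v

variable (E X) in
/-- Vector fields, with no regularity. -/
abbrev VField := Π x : X, TangentSpace 𝓘(ℝ, E) x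

/-- The vector field `V` is smooth near `x` (as a section of the real tangent bundle). -/
def VField.SmoothAt (V : VField E X) (x : X) : Prop :=
  ContMDiffAt 𝓘(ℝ, E) 𝓘(ℝ, E).tangent ∞
    (fun y => (⟨y, V y⟩ : TangentBundle 𝓘(ℝ, E) X)) x

/-- The vector field `V` is differentiable at `x` (as a section of the real tangent bundle). -/
def VField.DiffAt (V : VField E X) (x : X) : Prop :=
  MDifferentiableAt 𝓘(ℝ, E) 𝓘(ℝ, E).tangent
    (fun y => (⟨y, V y⟩ : TangentBundle 𝓘(ℝ, E) X)) x

variable (E X) in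
/-- Affine connections on the real tangent bundle. `cov Y x v` is the covariant derivative at `x`
of the vector field `Y` in the direction `v`. -/
abbrev AffineConnection :=
  CovariantDerivative 𝓘(ℝ, E) E (fun x : X => TangentSpace 𝓘(ℝ, E) x)

/-- The curvature `R(V, W)Z = ∇_V ∇_W Z - ∇_W ∇_V Z - ∇_{[V, W]} Z` at the point `x`. -/
def curvature (cov : AffineConnection E X) (V W Z : VField E X) (x : X) :
    TangentSpace 𝓘(ℝ, E) x :=
  cov (fun y => cov Z y (W y)) x (V x) - cov (fun y => cov Z y (V y)) x (W x)
    - cov Z x (mlieBracket 𝓘(ℝ, E) V W x)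

variable (E X) in
/-- Real `1`-forms, not necessarily smooth. -/
abbrev OneForm := Π x : X, TangentSpace 𝓘(ℝ, E) x →L[ℝ] ℝ

/-- A `1`-form is smooth if it is a smooth section of the cotangent bundle. -/
def OneForm.IsSmooth (θ : OneForm E X) : Prop :=
  ContMDiff 𝓘(ℝ, E) (𝓘(ℝ, E).prod 𝓘(ℝ, E →L[ℝ] ℝ)) ∞
    (fun x => Bundle.TotalSpace.mk' (E →L[ℝ] ℝ)
      (E := fun x : X => TangentSpace 𝓘(ℝ, E) x →L[ℝ] ℝ) x (θ x))

/-- `(dθ)(V, W) = V(θ(W)) - W(θ(V)) - θ([V, W])` at the point `x`. -/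
def OneForm.extDeriv (θ : OneForm E X) (V W : VField E X) (x : X) : ℝ :=
  mvfderiv 𝓘(ℝ, E) (fun y => θ y (W y)) x (V x) - mvfderiv 𝓘(ℝ, E) (fun y => θ y (V y)) x (W x)
    - θ x (mlieBracket 𝓘(ℝ, E) V W x)

/-- `dθ = 0`. -/
def OneForm.IsClosed (θ : OneForm E X) : Prop :=
  ∀ (x : X) (V W : VField E X),
    V.SmoothAt x → W.SmoothAt x → θ.extDeriv V W x = 0

namespace HermitianMetric

variable (g : HermitianMetric E X)

/-- The fundamental form `ω(u, v) = g(u, Jv)`. -/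
def fundForm (x : X) (u v : TangentSpace 𝓘(ℝ, E) x) : ℝ := g.inner x u (J x v)

/-- `(dω)(V, W, Z)` for the fundamental form `ω`, at the point `x`. -/
def extDerivFundForm (V W Z : VField E X) (x : X) : ℝ :=
  mvfderiv 𝓘(ℝ, E) (fun y => g.fundForm y (W y) (Z y)) x (V x)
    + mvfderiv 𝓘(ℝ, E) (fun y => g.fundForm y (Z y) (V y)) x (W x)
    + mvfderiv 𝓘(ℝ, E) (fun y => g.fundForm y (V y) (W y)) x (Z x)
    - g.fundForm x (mlieBracket 𝓘(ℝ, E) V W x) (Z x)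
    - g.fundForm x (mlieBracket 𝓘(ℝ, E) W Z x) (V x)
    - g.fundForm x (mlieBracket 𝓘(ℝ, E) Z V x) (W x)

/-- `dω = θ ∧ ω`, evaluated on arbitrary smooth vector fields. -/
def ExtDerivEqWedge (θ : OneForm E X) : Prop :=
  ∀ (x : X) (V W Z : VField E X),
    V.SmoothAt x → W.SmoothAt x → Z.SmoothAt x →
      g.extDerivFundForm V W Z x =
        θ x (V x) * g.fundForm x (W x) (Z x) + θ x (W x) * g.fundForm x (Z x) (V x)
          + θ x (Z x) * g.fundForm x (V x) (W x)

/-- On a complex surface, `θ` is the Lee form of `g` if it is a smooth `1`-form with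
`dω = θ ∧ ω`. (In complex dimension `n` the condition would be `dωⁿ⁻¹ = θ ∧ ωⁿ⁻¹`.) -/
def IsLeeFormOfSurface (θ : OneForm E X) : Prop := θ.IsSmooth ∧ g.ExtDerivEqWedge θ

/-- `g` is locally conformally Kähler: `dω = α ∧ ω` for a closed smooth `1`-form `α`. -/
def IsLocallyConformallyKahler : Prop :=
  ∃ α : OneForm E X, α.IsSmooth ∧ α.IsClosed ∧ g.ExtDerivEqWedge α

/-- `cov` is the Bismut connection of `g`: it is Hermitian, that is `∇g = 0` and `∇J = 0`, and its
torsion `T(u, v, w) = g(T(u, v), w)` is totally skew-symmetric. (Skew-symmetry in `u, v` holds for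
every torsion tensor.) -/
structure IsBismutConnection (cov : AffineConnection E X) : Prop where
  metric : ∀ (x : X) (W Z : VField E X), W.DiffAt x → Z.DiffAt x →
    ∀ v : TangentSpace 𝓘(ℝ, E) x,
      mvfderiv 𝓘(ℝ, E) (fun y => g.inner y (W y) (Z y)) x v =
        g.inner x (cov W x v) (Z x) + g.inner x (W x) (cov Z x v)
  complex : ∀ (x : X) (W : VField E X), W.DiffAt x →
    ∀ v : TangentSpace 𝓘(ℝ, E) x, cov (fun y => J y (W y)) x v = J x (cov W x v)
  torsion_skew : ∀ (x : X) (u v w : TangentSpace 𝓘(ℝ, E) x),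
    g.inner x (cov.torsion x u v) w = - g.inner x (cov.torsion x u w) v

/-- The curvature condition `R(x, y, z, w) = R(Jx, Jy, z, w)`, where
`R(x, y, z, w) = g(R(x, y)z, w)`. -/
def CurvatureJInvariant (cov : AffineConnection E X) : Prop :=
  ∀ (x : X) (V W Z : VField E X) (w : TangentSpace 𝓘(ℝ, E) x),
    V.SmoothAt x → W.SmoothAt x → Z.SmoothAt x →
      g.inner x (curvature cov V W Z x) w =
        g.inner x (curvature cov (fun y => J y (V y)) (fun y => J y (W y)) Z x) w

end HermitianMetric

end BismutSurface

end

/-! The curvature condition makes `dθ` a primitive real form of type (1,1). In complex dimension two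
the square of such a form has a pointwise sign. As `dθ` is exact on each piece of a partition of
unity, Stokes makes the integral of its square zero, so `dθ` vanishes. Compactness enters only in
this last step.

Type (1,1). Because `∇J = 0` and `J` is integrable, total skewness of the torsion forces `T =
-dω(J·, J·, J·)` (`torsion_eq`). With `dω = θ ∧ ω` this makes the (0,1)-part `A` of the connection
in a holomorphic chart an algebraic expression in `g` and `θ`, free of derivatives of `g`
(`christoffel_antiholomorphic`). Invariance of `R` under `J` in its first two arguments says that
the (0,2)-part of the curvature is zero, which is a flatness equation for `A`
(`antiholomorphic_flat`). Two scalar components of it, with the derivatives of `g` eliminated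
through `dω = θ ∧ ω`, give `dθ(x, y) = dθ(Jx, Jy)` for Hermitian-orthogonal `x, y`
(`dOne_eq_dOne_of_orthogonal`).

Primitivity and sign. Differentiating `dω = θ ∧ ω` gives `dθ ∧ ω = 0` (`dOne_wedge`). On an
orthogonal frame these two facts turn `dθ ∧ dθ` into minus a weighted sum of squares of all the
components of `dθ` (`wedge_self_nonpos`). Then `∫ dθ ∧ dθ = 0` yields `dθ = 0`
(`isClosed_of_wedge_nonpos`).

The second conclusion also needs a Lee form to exist. On a surface `θ ↦ θ ∧ ω` is an isomorphism
from `1`-forms to `3`-forms; it is inverted smoothly in every chart and the results are glued by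
uniqueness (`exists_isLeeFormOfSurface`). -/

noncomputable section

namespace BismutSurface

open Filter Topology MeasureTheory

set_option linter.unusedSectionVars false
set_option linter.unusedSimpArgs false

/-! ### Complex structure, vector fields and Lie brackets in holomorphic charts. -/

section

variable {E : Type*} [NormedAddCommGroup E] [NormedSpace ℂ E]
  {X : Type*} [TopologicalSpace X] [ChartedSpace E X] [IsManifold 𝓘(ℂ, E) ω X]

/-- The differential at `y` of the chart around `a`. -/
def toChart (a y : X) : TangentSpace 𝓘(ℝ, E) y →L[ℝ] E :=
  (trivializationAt E (TangentSpace 𝓘(ℝ, E) : X → Type _) a).continuousLinearMapAt ℝ y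

/-- The inverse of the differential at `y` of the chart around `a` (zero if `y` is not in the
domain of the chart). -/
def ofChart (a y : X) : E →L[ℝ] TangentSpace 𝓘(ℝ, E) y :=
  (trivializationAt E (TangentSpace 𝓘(ℝ, E) : X → Type _) a).symmL ℝ y

section basic

variable {a y : X}

lemma toChart_ofChart (hy : y ∈ (chartAt E a).source) (u : E) : toChart a y (ofChart a y u) = u :=
  Bundle.Trivialization.continuousLinearMapAt_symmL _ (by simpa using hy) u

lemma ofChart_toChart (hy : y ∈ (chartAt E a).source) (v : TangentSpace 𝓘(ℝ, E) y) :
    ofChart a y (toChart a y v) = v :=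
  Bundle.Trivialization.symmL_continuousLinearMapAt _ (by simpa using hy) v

lemma ofChart_of_notMem (hy : y ∉ (chartAt E a).source) (u : E) : ofChart a y u = 0 :=
  Bundle.Trivialization.symmL_apply_of_notMem _ (by simpa using hy) u

lemma toChart_apply (hy : y ∈ (chartAt E a).source) (v : TangentSpace 𝓘(ℝ, E) y) :
    toChart a y v = (trivializationAt E (TangentSpace 𝓘(ℝ, E) : X → Type _) a ⟨y, v⟩).2 := by
  rw [toChart, Bundle.Trivialization.continuousLinearMapAt_apply,
    Bundle.Trivialization.linearMapAt_apply, if_pos (by simpa using hy)]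

lemma toChart_eq_mfderiv (hy : y ∈ (chartAt E a).source) :
    @Eq (E →L[ℝ] E) (toChart a y) (mfderiv 𝓘(ℝ, E) 𝓘(ℝ, E) (extChartAt 𝓘(ℝ, E) a) y) :=
  TangentBundle.continuousLinearMapAt_trivializationAt hy

/-- Transition maps are holomorphic, so the real derivative is the restriction of a complex linear
one. This gives the chart independence of `J` and, in `det_transition_pos`, the orientation. -/
lemma fderiv_transition_smul_I {a b : X} {p : E}
    (hp : p ∈ ((chartAt E a).symm.trans (chartAt E b)).source) (v : E) :
    fderiv ℝ (chartAt E b ∘ (chartAt E a).symm) p (Complex.I • v) =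
      Complex.I • fderiv ℝ (chartAt E b ∘ (chartAt E a).symm) p v := by
  have h := (contDiffGroupoid ω 𝓘(ℂ, E)).compatible (chart_mem_atlas E a) (chart_mem_atlas E b)
  rw [contDiffGroupoid, mem_groupoid_of_pregroupoid] at h
  have h1 : ContDiffOn ℂ ω (chartAt E b ∘ (chartAt E a).symm)
    ((chartAt E a).symm.trans (chartAt E b)).source := by
    simpa [contDiffPregroupoid, mfld_simps] using h.1
  have h2 : DifferentiableAt ℂ (chartAt E b ∘ (chartAt E a).symm) p :=
    (h1.contDiffAt (((chartAt E a).symm.trans (chartAt E b)).open_source.mem_nhds hp)).differentiableAt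
      (by simp)
  rw [h2.fderiv_restrictScalars ℝ]
  simp

lemma toChart_J (hy : y ∈ (chartAt E a).source) (v : TangentSpace 𝓘(ℝ, E) y) :
    toChart a y (J y v) = Complex.I • toChart a y v := by
  have h := TangentBundle.continuousLinearMapAt_trivializationAt_eq_core (I := 𝓘(ℝ, E)) hy
  have h1 : ∀ w : E, toChart a y w = fderiv ℝ (chartAt E a ∘ (chartAt E y).symm)
      (chartAt E y y) w := by
    intro w
    have := congr($h w)
    rw [tangentBundleCore_coordChange_achart] at this
    refine this.trans ?_
    simp only [mfld_simps]
    rw [← fderivWithin_univ]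
  have h2 : ∀ w : E, toChart a y (Complex.I • w : E) = Complex.I • toChart a y w := fun w => by
    rw [h1, h1, fderiv_transition_smul_I]
    simp [hy, mfld_simps]
  exact h2 v

lemma ofChart_smul_I (hy : y ∈ (chartAt E a).source) (u : E) :
    ofChart a y (Complex.I • u) = J y (ofChart a y u) := by
  rw [← ofChart_toChart hy (J y (ofChart a y u)), toChart_J hy, toChart_ofChart hy]

end basic

lemma ofChart_eq_mfderiv {a : X} {p : E} (hp : p ∈ (chartAt E a).target) :
    @Eq (E →L[ℝ] E) (ofChart a ((chartAt E a).symm p))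
      (mfderiv 𝓘(ℝ, E) 𝓘(ℝ, E) (chartAt E a).symm p) := by
  have hy := (chartAt E a).map_target hp
  have := TangentBundle.symmL_trivializationAt (I := 𝓘(ℝ, E)) hy
  have h3 : extChartAt 𝓘(ℝ, E) a ((chartAt E a).symm p) = p := by
    simp [(chartAt E a).right_inv hp, mfld_simps]
  rw [h3] at this
  refine this.trans ?_
  have h5 : Set.range (𝓘(ℝ, E) : E → E) = Set.univ := Set.range_id
  exact (congrArg (mfderivWithin 𝓘(ℝ, E) 𝓘(ℝ, E) (chartAt E a).symm · p) h5).trans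
    (congrFun mfderivWithin_univ p)

/-- The vector field with components `f` in the chart around `a`, extended by zero. -/
def coordField (a : X) (f : E → E) : VField E X := fun y => ofChart a y (f (chartAt E a y))

/-- The components of a vector field in the chart around `a`. -/
def components (a : X) (V : VField E X) : E → E := fun p =>
  toChart a ((chartAt E a).symm p) (V ((chartAt E a).symm p))

lemma mlieBracket_eq_lieBracket {F : Type*} [NormedAddCommGroup F] [NormedSpace ℝ F]
    (V W : Π x : F, TangentSpace 𝓘(ℝ, F) x) :
    mlieBracket 𝓘(ℝ, F) V W = lieBracket ℝ V W := by
  rw [← mlieBracketWithin_univ, mlieBracketWithin_eq_lieBracketWithin]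
  exact lieBracketWithin_univ

section fields

variable {a : X} {p : E} (hp : p ∈ (chartAt E a).target)
include hp

omit [NormedSpace ℂ E] [IsManifold 𝓘(ℂ, E) ω X] in
lemma symm_mem_source : (chartAt E a).symm p ∈ (chartAt E a).source :=
  (chartAt E a).map_target hp

lemma components_coordField (f : E → E) : components a (coordField a f) p = f p := by
  simp [components, coordField, toChart_ofChart (symm_mem_source hp), (chartAt E a).right_inv hp]

lemma smoothAt_coordField {f : E → E} (hf : ContDiffAt ℝ ∞ f p) :
    (coordField a f).SmoothAt ((chartAt E a).symm p) := by
  have hy := symm_mem_source hp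
  unfold VField.SmoothAt
  rw [Bundle.Trivialization.contMDiffAt_section_iff (IB := 𝓘(ℝ, E))
    (e := trivializationAt E (TangentSpace 𝓘(ℝ, E) : X → Type _) a) (by simpa using hy)]
  have h1 : ContMDiffAt 𝓘(ℝ, E) 𝓘(ℝ, E) ∞ (fun y => f (chartAt E a y))
      ((chartAt E a).symm p) := by
    have h2 : ContMDiffAt 𝓘(ℝ, E) 𝓘(ℝ, E) ∞ f (chartAt E a ((chartAt E a).symm p)) := by
      rw [(chartAt E a).right_inv hp]; exact hf.contMDiffAt
    exact h2.comp _ (contMDiffAt_of_mem_maximalAtlas (IsManifold.chart_mem_maximalAtlas a) hy)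
  refine h1.congr_of_eventuallyEq ?_
  filter_upwards [(chartAt E a).open_source.mem_nhds hy] with z hz
  exact (toChart_apply hz _).symm.trans (toChart_ofChart hz (f (chartAt E a z)))

lemma diffAt_coordField {f : E → E} (hf : DifferentiableAt ℝ f p) :
    (coordField a f).DiffAt ((chartAt E a).symm p) := by
  have hy := symm_mem_source hp
  unfold VField.DiffAt
  rw [Bundle.Trivialization.mdifferentiableAt_section_iff (IB := 𝓘(ℝ, E))
    (e := trivializationAt E (TangentSpace 𝓘(ℝ, E) : X → Type _) a) _ (by simpa using hy)]
  have h1 : MDifferentiableAt 𝓘(ℝ, E) 𝓘(ℝ, E) (fun y => f (chartAt E a y))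
      ((chartAt E a).symm p) := by
    have h2 : MDifferentiableAt 𝓘(ℝ, E) 𝓘(ℝ, E) f (chartAt E a ((chartAt E a).symm p)) := by
      rw [(chartAt E a).right_inv hp]; exact hf.mdifferentiableAt
    exact h2.comp _ (mdifferentiableAt_atlas (chart_mem_atlas E a) hy)
  refine h1.congr_of_eventuallyEq ?_
  filter_upwards [(chartAt E a).open_source.mem_nhds hy] with z hz
  exact (toChart_apply hz _).symm.trans (toChart_ofChart hz (f (chartAt E a z)))

lemma contDiffAt_components {V : VField E X} (hV : V.SmoothAt ((chartAt E a).symm p)) :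
    ContDiffAt ℝ ∞ (components a V) p := by
  have hy := symm_mem_source hp
  unfold VField.SmoothAt at hV
  rw [Bundle.Trivialization.contMDiffAt_section_iff (IB := 𝓘(ℝ, E))
    (e := trivializationAt E (TangentSpace 𝓘(ℝ, E) : X → Type _) a) (by simpa using hy)] at hV
  have h1 := hV.comp p (contMDiffAt_symm_of_mem_maximalAtlas
    (I := 𝓘(ℝ, E)) (n := ∞) (IsManifold.chart_mem_maximalAtlas a) hp)
  refine (contMDiffAt_iff_contDiffAt.1 h1).congr_of_eventuallyEq ?_
  filter_upwards [(chartAt E a).open_target.mem_nhds hp] with q hq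
  exact toChart_apply (symm_mem_source hq) _

lemma mvfderiv_eq_fderiv {f : X → ℝ} (hf : MDifferentiableAt 𝓘(ℝ, E) 𝓘(ℝ, ℝ) f ((chartAt E a).symm p))
    (v : TangentSpace 𝓘(ℝ, E) ((chartAt E a).symm p)) :
    mvfderiv 𝓘(ℝ, E) f ((chartAt E a).symm p) v =
      fderiv ℝ (f ∘ (chartAt E a).symm) p (toChart a ((chartAt E a).symm p) v) := by
  have hy := symm_mem_source hp
  have h := mfderiv_comp p hf (mdifferentiableAt_atlas_symm (I := 𝓘(ℝ, E)) (chart_mem_atlas E a) hp)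
  have h2 := ofChart_eq_mfderiv (E := E) hp
  have h3 := congrArg (fun L : E →L[ℝ] ℝ => L (toChart a ((chartAt E a).symm p) v))
    (mfderiv_eq_fderiv.symm.trans h)
  refine Eq.trans ?_ h3.symm
  conv_lhs => rw [← ofChart_toChart hy v]
  let L : E →L[ℝ] ℝ := mvfderiv 𝓘(ℝ, E) f ((chartAt E a).symm p)
  have h4 : L (ofChart a ((chartAt E a).symm p) (toChart a ((chartAt E a).symm p) v)) = L _ :=
    congrArg L (DFunLike.congr_fun h2 (toChart a ((chartAt E a).symm p) v))
  exact h4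

/-- Reading components as a pullback along the inverse chart lets naturality of the Lie bracket
carry brackets to the model space. -/
lemma components_eq_mpullback (V : VField E X) :
    components a V p = mpullback 𝓘(ℝ, E) 𝓘(ℝ, E) (chartAt E a).symm V p := by
  have hy := symm_mem_source hp
  rw [mpullback_apply]
  have h2 := ofChart_eq_mfderiv (E := E) hp
  have : ContinuousLinearMap.inverse (ofChart a ((chartAt E a).symm p)) = toChart a ((chartAt E a).symm p) :=
    ContinuousLinearMap.inverse_eq
      (ContinuousLinearMap.ext fun v => ofChart_toChart hy v)
      (ContinuousLinearMap.ext fun v => toChart_ofChart hy v)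
  have h5 : @Eq (E →L[ℝ] E) (ContinuousLinearMap.inverse (ofChart a ((chartAt E a).symm p)))
    (ContinuousLinearMap.inverse (mfderiv 𝓘(ℝ, E) 𝓘(ℝ, E) (chartAt E a).symm p)) :=
      congrArg (ContinuousLinearMap.inverse (R := ℝ) (M := E) (M₂ := E)) h2
  have h6 := congr($h5 (V ((chartAt E a).symm p)))
  rw [components, ← this]
  exact h6

lemma components_mlieBracket [CompleteSpace E] {V W : VField E X} (hV : V.DiffAt ((chartAt E a).symm p))
    (hW : W.DiffAt ((chartAt E a).symm p)) :
    components a (mlieBracket 𝓘(ℝ, E) V W) p =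
      lieBracket ℝ (components a V) (components a W) p := by
  have h1 := mpullback_mlieBracket (n := ∞) hV hW
    (contMDiffAt_symm_of_mem_maximalAtlas (I := 𝓘(ℝ, E)) (IsManifold.chart_mem_maximalAtlas a) hp)
    (by simp only [minSmoothness_of_isRCLikeNormedField]; exact WithTop.coe_le_coe.2 (le_top : (2 : ℕ∞) ≤ ⊤))
  refine (components_eq_mpullback hp _).trans (h1.trans ?_)
  refine Eq.trans ?_ (congrFun (mlieBracket_eq_lieBracket (components a V) (components a W)) p)
  apply Filter.EventuallyEq.mlieBracket_vectorField_eq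
  · filter_upwards [(chartAt E a).open_target.mem_nhds hp] with q hq
    exact (components_eq_mpullback hq V).symm
  · filter_upwards [(chartAt E a).open_target.mem_nhds hp] with q hq
    exact (components_eq_mpullback hq W).symm

end fields

end

/-! ### Metric, one-forms and exterior derivatives in a chart. -/

section

variable {E : Type*} [NormedAddCommGroup E] [NormedSpace ℂ E]
  {X : Type*} [TopologicalSpace X] [ChartedSpace E X] [IsManifold 𝓘(ℂ, E) ω X]

/-- The metric in the chart around `a`. -/
def HermitianMetric.inChart (g : HermitianMetric E X) (a : X) (p : E) : E →L[ℝ] E →L[ℝ] ℝ :=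
  (ContinuousLinearMap.precomp ℝ (ofChart a ((chartAt E a).symm p))).comp
    ((g.inner ((chartAt E a).symm p)).comp (ofChart a ((chartAt E a).symm p)))

/-- A one-form in the chart around `a`. -/
def OneForm.inChart (θ : OneForm E X) (a : X) (p : E) : E →L[ℝ] ℝ :=
  (θ ((chartAt E a).symm p)).comp (ofChart a ((chartAt E a).symm p))

/-- The exterior derivative of a one-form on a vector space. -/
def dOne {F : Type*} [NormedAddCommGroup F] [NormedSpace ℝ F] (Θ : F → F →L[ℝ] ℝ) (p u v : F) : ℝ :=
  fderiv ℝ Θ p u v - fderiv ℝ Θ p v u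

/-- The exterior derivative of `(v, w) ↦ G(v, j w)` on a vector space. -/
def dFund {F : Type*} [NormedAddCommGroup F] [NormedSpace ℝ F] (j : F →L[ℝ] F)
    (G : F → F →L[ℝ] F →L[ℝ] ℝ) (p u v w : F) : ℝ :=
  fderiv ℝ G p u v (j w) + fderiv ℝ G p v w (j u) + fderiv ℝ G p w u (j v)

variable (E) in
/-- Multiplication by `i` as a real linear map. -/
def mulI : E →L[ℝ] E := (Complex.I • ContinuousLinearMap.id ℂ E).restrictScalars ℝ

@[simp] lemma mulI_apply (u : E) : mulI E u = Complex.I • u := rfl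

lemma ofChart_mulI {a y : X} (hy : y ∈ (chartAt E a).source) (u : E) :
    ofChart a y (mulI E u) = J y (ofChart a y u) := ofChart_smul_I hy u

lemma VField.SmoothAt.diffAt {V : VField E X} {x : X} (h : V.SmoothAt x) : V.DiffAt x :=
  h.mdifferentiableAt (by simp)

omit [IsManifold 𝓘(ℂ, E) ω X] in
lemma J_J (x : X) (v : TangentSpace 𝓘(ℝ, E) x) : J x (J x v) = -v := by
  have h : ∀ u : E, Complex.I • Complex.I • u = -u := fun u => by rw [smul_smul]; simp
  exact h v

lemma HermitianMetric.inner_J_right (g : HermitianMetric E X) (x : X)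
    (u v : TangentSpace 𝓘(ℝ, E) x) : g.inner x u (J x v) = - g.inner x (J x u) v := by
  rw [← g.inner_J x u (J x v), J_J, map_neg]

section
variable {a : X} {p : E}

lemma HermitianMetric.inChart_apply (g : HermitianMetric E X) (u v : E) :
    g.inChart a p u v = g.inner ((chartAt E a).symm p) (ofChart a ((chartAt E a).symm p) u)
      (ofChart a ((chartAt E a).symm p) v) := rfl

lemma OneForm.inChart_apply (θ : OneForm E X) (u : E) :
    θ.inChart a p u = θ ((chartAt E a).symm p) (ofChart a ((chartAt E a).symm p) u) := rfl

lemma smoothAt_inner (g : HermitianMetric E X) {V W : VField E X} {x : X} (hV : V.SmoothAt x)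
    (hW : W.SmoothAt x) :
    ContMDiffAt 𝓘(ℝ, E) 𝓘(ℝ, ℝ) ∞ (fun y => g.inner y (V y) (W y)) x := by
  have := ContMDiffAt.clm_bundle_apply₂ (F₁ := E) (F₂ := E) (F₃ := ℝ)
    (E₁ := (TangentSpace 𝓘(ℝ, E) : X → Type _)) (E₂ := (TangentSpace 𝓘(ℝ, E) : X → Type _))
    (E₃ := Bundle.Trivial X ℝ) (b := fun y : X => y) (g.contMDiff x) hV hW
  exact (Bundle.contMDiffAt_totalSpace.1 this).2

lemma OneForm.IsSmooth.apply {θ : OneForm E X} (h : θ.IsSmooth) {V : VField E X} {x : X}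
    (hV : V.SmoothAt x) : ContMDiffAt 𝓘(ℝ, E) 𝓘(ℝ, ℝ) ∞ (fun y => θ y (V y)) x := by
  have := ContMDiffAt.clm_bundle_apply (F₁ := E) (F₂ := ℝ)
    (E₁ := (TangentSpace 𝓘(ℝ, E) : X → Type _))
    (E₂ := Bundle.Trivial X ℝ) (b := fun y : X => y) (h x) hV
  exact (Bundle.contMDiffAt_totalSpace.1 this).2

lemma ContMDiffAt.comp_chart_symm {f : X → ℝ} (hp : p ∈ (chartAt E a).target)
    (hf : ContMDiffAt 𝓘(ℝ, E) 𝓘(ℝ, ℝ) ∞ f ((chartAt E a).symm p)) :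
    ContDiffAt ℝ ∞ (f ∘ (chartAt E a).symm) p :=
  contMDiffAt_iff_contDiffAt.1 (hf.comp p (contMDiffAt_symm_of_mem_maximalAtlas
    (I := 𝓘(ℝ, E)) (n := ∞) (IsManifold.chart_mem_maximalAtlas a) hp))

variable [FiniteDimensional ℂ E]

lemma HermitianMetric.contDiffOn_inChart (g : HermitianMetric E X) (a : X) :
    ContDiffOn ℝ ∞ (g.inChart a) (chartAt E a).target := by
  have : FiniteDimensional ℝ E := FiniteDimensional.complexToReal E
  rw [contDiffOn_clm_apply]
  intro u
  rw [contDiffOn_clm_apply]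
  intro v p hp
  refine ContDiffAt.contDiffWithinAt ?_
  refine (ContMDiffAt.comp_chart_symm hp (smoothAt_inner g
    (smoothAt_coordField hp (f := fun _ => u) contDiffAt_const)
    (smoothAt_coordField hp (f := fun _ => v) contDiffAt_const))).congr_of_eventuallyEq ?_
  exact Eventually.of_forall fun q => rfl

lemma OneForm.IsSmooth.contDiffOn_inChart {θ : OneForm E X} (h : θ.IsSmooth) (a : X) :
    ContDiffOn ℝ ∞ (θ.inChart a) (chartAt E a).target := by
  have : FiniteDimensional ℝ E := FiniteDimensional.complexToReal E
  rw [contDiffOn_clm_apply]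
  intro u p hp
  refine ContDiffAt.contDiffWithinAt ?_
  refine (ContMDiffAt.comp_chart_symm hp (h.apply
    (smoothAt_coordField hp (f := fun _ => u) contDiffAt_const))).congr_of_eventuallyEq ?_
  exact Eventually.of_forall fun q => rfl

variable (hp : p ∈ (chartAt E a).target)
include hp

lemma OneForm.IsSmooth.differentiableAt_inChart {θ : OneForm E X} (h : θ.IsSmooth) :
    DifferentiableAt ℝ (θ.inChart a) p :=
  ((h.contDiffOn_inChart a).contDiffAt ((chartAt E a).open_target.mem_nhds hp)).differentiableAt
    (by simp)

lemma HermitianMetric.differentiableAt_inChart (g : HermitianMetric E X) :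
    DifferentiableAt ℝ (g.inChart a) p :=
  ((g.contDiffOn_inChart a).contDiffAt ((chartAt E a).open_target.mem_nhds hp)).differentiableAt
    (by simp)

lemma mvfderiv_oneForm {θ : OneForm E X} (h : θ.IsSmooth) {V : VField E X}
    (hV : V.SmoothAt ((chartAt E a).symm p)) (v : TangentSpace 𝓘(ℝ, E) ((chartAt E a).symm p)) :
    mvfderiv 𝓘(ℝ, E) (fun y => θ y (V y)) ((chartAt E a).symm p) v =
      fderiv ℝ (θ.inChart a) p (toChart a _ v) (components a V p) +
        θ.inChart a p (fderiv ℝ (components a V) p (toChart a _ v)) := by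
  rw [mvfderiv_eq_fderiv hp ((h.apply hV).mdifferentiableAt (by simp))]
  have hd := (h.differentiableAt_inChart hp).hasFDerivAt.clm_apply
    ((contDiffAt_components hp hV).differentiableAt (by simp)).hasFDerivAt
  rw [Filter.EventuallyEq.fderiv_eq (f₁ := (fun y => θ y (V y)) ∘ (chartAt E a).symm)
    (f := fun q => θ.inChart a q (components a V q)), hd.fderiv]
  · simp [add_comm]
  · filter_upwards [(chartAt E a).open_target.mem_nhds hp] with q hq
    simp [OneForm.inChart_apply, components, ofChart_toChart (symm_mem_source hq)]

lemma OneForm.extDeriv_eq {θ : OneForm E X} (h : θ.IsSmooth) {V W : VField E X}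
    (hV : V.SmoothAt ((chartAt E a).symm p)) (hW : W.SmoothAt ((chartAt E a).symm p)) :
    θ.extDeriv V W ((chartAt E a).symm p) =
      dOne (θ.inChart a) p (components a V p) (components a W p) := by
  have : FiniteDimensional ℝ E := FiniteDimensional.complexToReal E
  have : CompleteSpace E := FiniteDimensional.complete ℝ E
  have h1 := components_mlieBracket hp hV.diffAt hW.diffAt
  have h2 : θ ((chartAt E a).symm p) (mlieBracket 𝓘(ℝ, E) V W ((chartAt E a).symm p)) =
      θ.inChart a p (components a (mlieBracket 𝓘(ℝ, E) V W) p) := by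
    simp [OneForm.inChart_apply, components, ofChart_toChart (symm_mem_source hp)]
  rw [OneForm.extDeriv, mvfderiv_oneForm hp h hW, mvfderiv_oneForm hp h hV, h2, h1, lieBracket, dOne]
  simp only [map_sub, components]
  ring

lemma mvfderiv_inner (g : HermitianMetric E X) {V W : VField E X}
    (hV : V.SmoothAt ((chartAt E a).symm p)) (hW : W.SmoothAt ((chartAt E a).symm p))
    (v : TangentSpace 𝓘(ℝ, E) ((chartAt E a).symm p)) :
    mvfderiv 𝓘(ℝ, E) (fun y => g.inner y (V y) (W y)) ((chartAt E a).symm p) v =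
      fderiv ℝ (g.inChart a) p (toChart a _ v) (components a V p) (components a W p) +
        g.inChart a p (fderiv ℝ (components a V) p (toChart a _ v)) (components a W p) +
        g.inChart a p (components a V p) (fderiv ℝ (components a W) p (toChart a _ v)) := by
  rw [mvfderiv_eq_fderiv hp ((smoothAt_inner g hV hW).mdifferentiableAt (by simp))]
  have hd := ((g.differentiableAt_inChart hp).hasFDerivAt.clm_apply
    ((contDiffAt_components hp hV).differentiableAt (by simp)).hasFDerivAt).clm_apply
    ((contDiffAt_components hp hW).differentiableAt (by simp)).hasFDerivAt
  rw [Filter.EventuallyEq.fderiv_eq (f₁ := (fun y => g.inner y (V y) (W y)) ∘ (chartAt E a).symm)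
    (f := fun q => g.inChart a q (components a V q) (components a W q)), hd.fderiv]
  · simp; ring
  · filter_upwards [(chartAt E a).open_target.mem_nhds hp] with q hq
    simp [HermitianMetric.inChart_apply, components, ofChart_toChart (symm_mem_source hq)]

omit [FiniteDimensional ℂ E] in
lemma smoothAt_of_components {V : VField E X} (hV : ContDiffAt ℝ ∞ (components a V) p) :
    V.SmoothAt ((chartAt E a).symm p) := by
  refine (smoothAt_coordField hp hV).congr_of_eventuallyEq ?_
  filter_upwards [(chartAt E a).open_source.mem_nhds (symm_mem_source hp)] with y hy
  obtain ⟨q, hq, rfl⟩ : ∃ q ∈ (chartAt E a).target, (chartAt E a).symm q = y :=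
    ⟨chartAt E a y, (chartAt E a).map_source hy, (chartAt E a).left_inv hy⟩
  refine congrArg (Bundle.TotalSpace.mk _) ?_
  change V _ = ofChart a ((chartAt E a).symm q) (components a V (chartAt E a _))
  rw [(chartAt E a).right_inv hq, components, ofChart_toChart (symm_mem_source hq)]

omit [FiniteDimensional ℂ E] in
lemma components_J (V : VField E X) :
    components a (fun y => J y (V y)) p = mulI E (components a V p) :=
  toChart_J (symm_mem_source hp) _

omit [FiniteDimensional ℂ E] in
lemma smoothAt_J {V : VField E X} (hV : V.SmoothAt ((chartAt E a).symm p)) :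
    VField.SmoothAt (fun y => J y (V y)) ((chartAt E a).symm p) := by
  refine smoothAt_of_components hp (((mulI E).contDiff.contDiffAt.comp p
    (contDiffAt_components hp hV)).congr_of_eventuallyEq ?_)
  filter_upwards [(chartAt E a).open_target.mem_nhds hp] with q hq
  exact components_J hq V

/-- The terms with derivatives of the components cancel against the bracket terms because `g(u, iv)`
is skew (`h3`); only the derivative of the metric survives. -/
lemma HermitianMetric.extDerivFundForm_eq (g : HermitianMetric E X) {V W Z : VField E X}
    (hV : V.SmoothAt ((chartAt E a).symm p)) (hW : W.SmoothAt ((chartAt E a).symm p))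
    (hZ : Z.SmoothAt ((chartAt E a).symm p)) :
    g.extDerivFundForm V W Z ((chartAt E a).symm p) =
      dFund (mulI E) (g.inChart a) p (components a V p) (components a W p) (components a Z p) := by
  have : FiniteDimensional ℝ E := FiniteDimensional.complexToReal E
  have : CompleteSpace E := FiniteDimensional.complete ℝ E
  have h1 : ∀ {V W : VField E X} (Z : VField E X), V.SmoothAt ((chartAt E a).symm p) →
      W.SmoothAt ((chartAt E a).symm p) →
      g.fundForm ((chartAt E a).symm p) (mlieBracket 𝓘(ℝ, E) V W ((chartAt E a).symm p))
        (Z ((chartAt E a).symm p)) =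
      g.inChart a p (fderiv ℝ (components a W) p (components a V p))
        (mulI E (components a Z p)) -
      g.inChart a p (fderiv ℝ (components a V) p (components a W p))
        (mulI E (components a Z p)) := by
    intro V W Z hV hW
    have h1 := components_mlieBracket hp hV.diffAt hW.diffAt
    have h2 : mlieBracket 𝓘(ℝ, E) V W ((chartAt E a).symm p) =
        ofChart a ((chartAt E a).symm p) (components a (mlieBracket 𝓘(ℝ, E) V W) p) := by
      simp [components, ofChart_toChart (symm_mem_source hp)]
    rw [← _root_.sub_apply, ← map_sub, ← lieBracket, ← h1, inChart_apply,
      ofChart_mulI (symm_mem_source hp), ← h2, fundForm, components,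
      ofChart_toChart (symm_mem_source hp)]
  have h2 : ∀ {V W : VField E X} (Z : VField E X), V.SmoothAt ((chartAt E a).symm p) →
      W.SmoothAt ((chartAt E a).symm p) →
      mvfderiv 𝓘(ℝ, E) (fun y => g.fundForm y (V y) (W y)) ((chartAt E a).symm p)
        (Z ((chartAt E a).symm p)) =
      fderiv ℝ (g.inChart a) p (components a Z p) (components a V p) (mulI E (components a W p)) +
      g.inChart a p (fderiv ℝ (components a V) p (components a Z p)) (mulI E (components a W p)) +
      g.inChart a p (components a V p) (mulI E (fderiv ℝ (components a W) p (components a Z p))) := by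
    intro V W Z hV hW
    have h3 : fderiv ℝ (components a (fun y => J y (W y))) p =
        (mulI E).comp (fderiv ℝ (components a W) p) := by
      rw [Filter.EventuallyEq.fderiv_eq (f := fun q => mulI E (components a W q))]
      · exact ((mulI E).hasFDerivAt.comp p
          ((contDiffAt_components hp hW).differentiableAt (by simp)).hasFDerivAt).fderiv
      · filter_upwards [(chartAt E a).open_target.mem_nhds hp] with q hq
        exact components_J hq W
    rw [show (fun y => g.fundForm y (V y) (W y)) = fun y => g.inner y (V y) (J y (W y)) from rfl,
      mvfderiv_inner hp g hV (smoothAt_J hp hW), components_J hp, h3]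
    rfl
  have h3 : ∀ u v, g.inChart a p u (mulI E v) = - g.inChart a p v (mulI E u) := by
    intro u v
    rw [inChart_apply, inChart_apply (u := v), ofChart_mulI (symm_mem_source hp),
      ofChart_mulI (symm_mem_source hp), g.inner_J_right, g.symm]
  rw [HermitianMetric.extDerivFundForm, h1 _ hV hW, h1 _ hW hZ, h1 _ hZ hV, h2 _ hW hZ, h2 _ hZ hV,
    h2 _ hV hW, dFund]
  linear_combination
    h3 (components a W p) (fderiv ℝ (components a Z) p (components a V p)) +
    h3 (components a Z p) (fderiv ℝ (components a V) p (components a W p)) +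
    h3 (components a V p) (fderiv ℝ (components a W) p (components a Z p))

end

end

/-! ### Christoffel symbols, torsion and curvature in a chart. -/

section

variable {E : Type*} [NormedAddCommGroup E] [NormedSpace ℂ E] [FiniteDimensional ℂ E]
  {X : Type*} [TopologicalSpace X] [ChartedSpace E X] [IsManifold 𝓘(ℂ, E) ω X]

/-- The covariant derivative in the chart around `a`: `covIn cov a f p u` is the derivative at `p`
in the direction `u` of the vector field with components `f`. -/
def covIn (cov : AffineConnection E X) (a : X) (f : E → E) (p : E) : E →L[ℝ] E :=
  (toChart a ((chartAt E a).symm p)).comp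
    ((cov (coordField a f) ((chartAt E a).symm p)).comp (ofChart a ((chartAt E a).symm p)))

section
variable {a : X} {p : E} (cov : AffineConnection E X)

omit [FiniteDimensional ℂ E] in
lemma covIn_apply (f : E → E) (u : E) : covIn cov a f p u =
    toChart a ((chartAt E a).symm p) (cov (coordField a f) ((chartAt E a).symm p)
      (ofChart a ((chartAt E a).symm p) u)) := rfl

variable (hp : p ∈ (chartAt E a).target)
include hp

omit [FiniteDimensional ℂ E] in
lemma covIn_add {f f' : E → E} (hf : DifferentiableAt ℝ f p) (hf' : DifferentiableAt ℝ f' p) :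
    covIn cov a (f + f') p = covIn cov a f p + covIn cov a f' p := by
  have h : coordField (X := X) a (f + f') = coordField a f + coordField a f' := by
    ext y; simp [coordField]
  ext u
  simp only [covIn_apply, h, _root_.add_apply]
  rw [cov.isCovariantDerivativeOn.add (diffAt_coordField hp hf) (diffAt_coordField hp hf')]
  simp

omit [FiniteDimensional ℂ E] in
lemma covIn_smul {g : E → ℝ} {f : E → E} (hg : DifferentiableAt ℝ g p)
    (hf : DifferentiableAt ℝ f p) (u : E) :
    covIn cov a (fun q => g q • f q) p u = g p • covIn cov a f p u + fderiv ℝ g p u • f p := by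
  have hy := symm_mem_source hp
  have h : coordField (X := X) a (fun q => g q • f q) =
      (fun y => g (chartAt E a y)) • coordField a f := by
    ext y; simp [coordField]
  have hd : MDifferentiableAt 𝓘(ℝ, E) 𝓘(ℝ, ℝ) (fun y => g (chartAt E a y))
      ((chartAt E a).symm p) := by
    have h2 : MDifferentiableAt 𝓘(ℝ, E) 𝓘(ℝ, ℝ) g (chartAt E a ((chartAt E a).symm p)) := by
      rw [(chartAt E a).right_inv hp]; exact hg.mdifferentiableAt
    exact h2.comp _ (mdifferentiableAt_atlas (chart_mem_atlas E a) hy)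
  have h3 : fderiv ℝ ((fun y => g (chartAt E a y)) ∘ (chartAt E a).symm) p = fderiv ℝ g p := by
    apply Filter.EventuallyEq.fderiv_eq
    filter_upwards [(chartAt E a).open_target.mem_nhds hp] with q hq
    simp [(chartAt E a).right_inv hq]
  simp only [covIn_apply, h]
  rw [cov.isCovariantDerivativeOn.leibniz (diffAt_coordField hp hf) hd]
  simp only [_root_.add_apply, map_add, _root_.smul_apply, map_smul,
    ContinuousLinearMap.smulRight_apply, (chartAt E a).right_inv hp]
  rw [mvfderiv_eq_fderiv hp hd, toChart_ofChart hy, h3]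
  simp [coordField, toChart_ofChart hy, (chartAt E a).right_inv hp]

lemma covIn_sum {ι : Type*} (s : Finset ι) {f : ι → E → E}
    (hf : ∀ i, DifferentiableAt ℝ (f i) p) :
    covIn cov a (∑ i ∈ s, f i) p = ∑ i ∈ s, covIn cov a (f i) p := by
  classical
  induction s using Finset.induction_on with
  | empty =>
    -- The derivative of the zero field is zero by the Leibniz rule with coefficient `0`.
    have := covIn_smul cov hp (g := fun _ => 0) (f := 0) (differentiableAt_const _)
      (differentiableAt_const _)
    ext u
    simpa using! this u
  | insert i s hi ih =>
    rw [Finset.sum_insert hi, Finset.sum_insert hi, covIn_add cov hp (hf i), ih]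
    exact DifferentiableAt.sum fun i _ => hf i

/-- This is `∇ = d + Γ`: after expanding `f` in a real basis, the Leibniz rule separates the
derivatives of the coefficients from their values at `p`. -/
lemma covIn_eq {f : E → E} (hf : DifferentiableAt ℝ f p) (u : E) :
    covIn cov a f p u = fderiv ℝ f p u + covIn cov a (fun _ => f p) p u := by
  have : FiniteDimensional ℝ E := FiniteDimensional.complexToReal E
  let b := Module.finBasis ℝ E
  let c := fun i => (b.coord i).toContinuousLinearMap
  have hc : ∀ x : E, x = ∑ i, c i x • b i := fun x => (b.sum_repr x).symm
  have hd : ∀ i, DifferentiableAt ℝ (fun q => c i (f q)) p := fun i =>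
    (c i).differentiableAt.comp p hf
  have e1 : f = ∑ i, fun q => c i (f q) • b i := by
    ext q; rw [Finset.sum_apply]; exact hc _
  have e2 : (fun _ => f p : E → E) = ∑ i, fun q => c i (f p) • b i := by
    ext q; rw [Finset.sum_apply]; exact hc _
  conv_lhs => rw [e1]
  rw [e2, covIn_sum cov hp _ fun i => (hd i).smul_const _, covIn_sum cov hp _ fun i =>
    differentiableAt_const _]
  simp only [_root_.sum_apply]
  conv_rhs => rw [hc (fderiv ℝ f p u)]
  rw [← Finset.sum_add_distrib]
  refine Finset.sum_congr rfl fun i _ => ?_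
  rw [covIn_smul cov hp (hd i) (differentiableAt_const _),
    covIn_smul cov hp (differentiableAt_const _) (differentiableAt_const _)]
  have : fderiv ℝ (fun q => c i (f q)) p = (c i).comp (fderiv ℝ f p) :=
    ((c i).hasFDerivAt.comp p hf.hasFDerivAt).fderiv
  rw [this]
  simp [add_comm]

lemma inChart_pos (g : HermitianMetric E X) (u : E) (hu : u ≠ 0) : 0 < g.inChart a p u u := by
  rw [HermitianMetric.inChart_apply]
  refine g.pos _ _ fun h => hu ?_
  rw [← toChart_ofChart (symm_mem_source hp) u, h, map_zero]

omit hp in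
lemma inChart_symm (g : HermitianMetric E X) (u v : E) :
    g.inChart a p u v = g.inChart a p v u := g.symm _ _ _

lemma inChart_mulI (g : HermitianMetric E X) (u v : E) :
    g.inChart a p (mulI E u) (mulI E v) = g.inChart a p u v := by
  rw [HermitianMetric.inChart_apply, ofChart_mulI (symm_mem_source hp),
    ofChart_mulI (symm_mem_source hp), g.inner_J, HermitianMetric.inChart_apply]

end

/-- The Christoffel symbols in the chart around `a`. -/
def christoffel (cov : AffineConnection E X) (a : X) (p u v : E) : E :=
  covIn cov a (fun _ => v) p u

section
variable {a : X} {p : E} {cov : AffineConnection E X}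

lemma coordField_const_apply (a y : X) (u : E) : coordField a (fun _ => u) y = ofChart a y u := rfl

/-- The equality holds on all of `X`, since `ofChart` is zero off the chart domain. A connection
acts on global fields, so this extension by zero, used again in `cov_coordField_const`, avoids a
locality argument. -/
lemma J_coordField_const (a : X) (u : E) :
    (fun y => J y (coordField a (fun _ => u) y)) = coordField a (fun _ => mulI E u) := by
  funext y
  by_cases hy : y ∈ (chartAt E a).source
  · rw [coordField_const_apply, coordField_const_apply, ofChart_mulI hy]
  · rw [coordField_const_apply, coordField_const_apply, ofChart_of_notMem hy,
      ofChart_of_notMem hy, map_zero]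

lemma cov_coordField_const (u v : E) :
    (fun y => cov (coordField a (fun _ => v)) y (coordField a (fun _ => u) y)) =
      coordField a (fun q => christoffel cov a q u v) := by
  funext y
  by_cases hy : y ∈ (chartAt E a).source
  · obtain ⟨q, hq, rfl⟩ : ∃ q ∈ (chartAt E a).target, (chartAt E a).symm q = y :=
      ⟨chartAt E a y, (chartAt E a).map_source hy, (chartAt E a).left_inv hy⟩
    simp only [coordField_const_apply]
    change _ = ofChart a ((chartAt E a).symm q) (christoffel cov a (chartAt E a _) u v)
    rw [(chartAt E a).right_inv hq, christoffel, covIn_apply, ofChart_toChart hy]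
  · rw [coordField_const_apply, ofChart_of_notMem hy, map_zero, coordField, ofChart_of_notMem hy]

variable (hp : p ∈ (chartAt E a).target)
include hp

lemma christoffel_add_right (u v v' : E) :
    christoffel cov a p u (v + v') = christoffel cov a p u v + christoffel cov a p u v' :=
  congr($(covIn_add cov hp (differentiableAt_const v) (differentiableAt_const v')) u)

lemma components_coordField_const_eventuallyEq (u : E) :
    components a (coordField (X := X) a fun _ => u) =ᶠ[𝓝 p] fun _ => u := by
  filter_upwards [(chartAt E a).open_target.mem_nhds hp] with q hq
  exact components_coordField hq _

lemma mlieBracket_coordField_const (u v : E) :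
    mlieBracket 𝓘(ℝ, E) (coordField a fun _ => u) (coordField a fun _ => v)
      ((chartAt E a).symm p) = 0 := by
  have : FiniteDimensional ℝ E := FiniteDimensional.complexToReal E
  have : CompleteSpace E := FiniteDimensional.complete ℝ E
  have h := components_mlieBracket hp (diffAt_coordField hp (differentiableAt_const u))
    (diffAt_coordField hp (differentiableAt_const v))
  rw [lieBracket, (components_coordField_const_eventuallyEq hp u).fderiv_eq,
    (components_coordField_const_eventuallyEq hp v).fderiv_eq] at h
  simp only [fderiv_fun_const, Pi.zero_apply, _root_.zero_apply, sub_zero] at h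
  rw [← ofChart_toChart (symm_mem_source hp) (mlieBracket _ _ _ _)]
  exact (congrArg _ h).trans (map_zero _)

namespace HermitianMetric.IsBismutConnection

variable {g : HermitianMetric E X} (h : g.IsBismutConnection cov)
include h

lemma fderiv_inChart (u v w : E) : fderiv ℝ (g.inChart a) p u v w =
    g.inChart a p (christoffel cov a p u v) w + g.inChart a p v (christoffel cov a p u w) := by
  have hv := smoothAt_coordField (X := X) hp (f := fun _ => v) contDiffAt_const
  have hw := smoothAt_coordField (X := X) hp (f := fun _ => w) contDiffAt_const
  have h1 := h.metric _ _ _ hv.diffAt hw.diffAt (ofChart a _ u)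
  rw [mvfderiv_inner hp g hv hw, toChart_ofChart (symm_mem_source hp),
    (components_coordField_const_eventuallyEq hp v).fderiv_eq,
    (components_coordField_const_eventuallyEq hp w).fderiv_eq,
    components_coordField hp, components_coordField hp] at h1
  simp only [fderiv_fun_const, Pi.zero_apply, _root_.zero_apply, map_zero, add_zero] at h1
  rw [h1, inChart_apply, inChart_apply, christoffel, christoffel, covIn_apply, covIn_apply,
    ofChart_toChart (symm_mem_source hp), ofChart_toChart (symm_mem_source hp)]
  rfl

lemma christoffel_mulI (u v : E) :
    christoffel cov a p u (mulI E v) = mulI E (christoffel cov a p u v) := by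
  have h1 := h.complex _ _ (diffAt_coordField hp (differentiableAt_const v)) (ofChart a _ u)
  rw [J_coordField_const] at h1
  rw [christoffel, covIn_apply, h1, toChart_J (symm_mem_source hp)]
  rfl

lemma torsion_christoffel (u v w : E) :
    g.inChart a p (christoffel cov a p u v - christoffel cov a p v u) w =
      - g.inChart a p (christoffel cov a p u w - christoffel cov a p w u) v := by
  have : FiniteDimensional ℝ E := FiniteDimensional.complexToReal E
  have : CompleteSpace E := FiniteDimensional.complete ℝ E
  have key : ∀ u v : E, cov.torsion ((chartAt E a).symm p) (ofChart a _ u) (ofChart a _ v) =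
      ofChart a _ (christoffel cov a p u v - christoffel cov a p v u) := by
    intro u v
    have h1 := cov.torsion_apply (diffAt_coordField (X := X) hp (differentiableAt_const u))
      (diffAt_coordField (X := X) hp (differentiableAt_const v))
    rw [mlieBracket_coordField_const hp, sub_zero] at h1
    refine h1.trans ?_
    rw [map_sub, christoffel, christoffel, covIn_apply, covIn_apply,
      ofChart_toChart (symm_mem_source hp), ofChart_toChart (symm_mem_source hp)]
    rfl
  have h2 := h.torsion_skew _ (ofChart a ((chartAt E a).symm p) u) (ofChart a _ v) (ofChart a _ w)
  rw [key, key] at h2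
  exact h2

-- Constant coordinate fields commute, so the curvature is `∂_u Γ_v - ∂_v Γ_u + [Γ_u, Γ_v]`. The
-- connection carries no regularity of its own; `hd` is later supplied by
-- `IsLocalBismut.differentiableAt`.
omit h in
lemma curvature_inChart (hd : ∀ u v, DifferentiableAt ℝ (fun q => christoffel cov a q u v) p)
    (u v w : E) :
    toChart a ((chartAt E a).symm p) (curvature cov (coordField a fun _ => u)
      (coordField a fun _ => v) (coordField a fun _ => w) ((chartAt E a).symm p)) =
    fderiv ℝ (fun q => christoffel cov a q v w) p u
      + christoffel cov a p u (christoffel cov a p v w)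
      - (fderiv ℝ (fun q => christoffel cov a q u w) p v
      + christoffel cov a p v (christoffel cov a p u w)) := by
  rw [curvature, mlieBracket_coordField_const hp, map_zero, sub_zero, cov_coordField_const,
    cov_coordField_const, map_sub]
  have := fun u v w : E => covIn_eq cov hp (hd v w) u
  simp only [covIn_apply cov (fun q => christoffel cov a q _ _)] at this
  exact congrArg₂ _ (this u v w) (this v u w)

omit h in
lemma _root_.BismutSurface.HermitianMetric.CurvatureJInvariant.inChart (hR : g.CurvatureJInvariant cov)
    (hd : ∀ u v, DifferentiableAt ℝ (fun q => christoffel cov a q u v) p)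
    (u v w : E) :
    fderiv ℝ (fun q => christoffel cov a q v w) p u
      + christoffel cov a p u (christoffel cov a p v w)
      - (fderiv ℝ (fun q => christoffel cov a q u w) p v
      + christoffel cov a p v (christoffel cov a p u w)) =
    fderiv ℝ (fun q => christoffel cov a q (mulI E v) w) p (mulI E u)
      + christoffel cov a p (mulI E u) (christoffel cov a p (mulI E v) w)
      - (fderiv ℝ (fun q => christoffel cov a q (mulI E u) w) p (mulI E v)
      + christoffel cov a p (mulI E v) (christoffel cov a p (mulI E u) w)) := by
  rw [← curvature_inChart hp hd, ← curvature_inChart hp hd]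
  have h1 := fun z => hR _ _ _ _ z (smoothAt_coordField (X := X) hp (f := fun _ => u) contDiffAt_const)
    (smoothAt_coordField (X := X) hp (f := fun _ => v) contDiffAt_const)
    (smoothAt_coordField (X := X) hp (f := fun _ => w) contDiffAt_const)
  simp only [J_coordField_const] at h1
  congr 1
  -- If the two curvature vectors differed, their difference would pair positively with itself,
  -- while `hR` tested on that difference makes the pairing zero.
  by_contra hne
  have h2 := g.pos _ _ (sub_ne_zero.2 hne)
  have h3 := h1 (curvature cov (coordField a fun _ => u)
      (coordField a fun _ => v) (coordField a fun _ => w) ((chartAt E a).symm p) -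
     curvature cov (coordField a fun _ => mulI E u)
      (coordField a fun _ => mulI E v) (coordField a fun _ => w) ((chartAt E a).symm p))
  rw [map_sub, sub_pos] at h2
  exact h2.ne' ((g.symm _ _ _).trans (h3.trans (g.symm _ _ _)))

end HermitianMetric.IsBismutConnection
end

end

section

/-! ### Hermitian linear algebra and local computations -/

section pointwise

variable {F : Type*} [NormedAddCommGroup F] [NormedSpace ℝ F]

/-- `B` is a Hermitian inner product with respect to the complex structure `j`. -/
structure IsHermitianForm (j : F →L[ℝ] F) (B : F →L[ℝ] F →L[ℝ] ℝ) : Prop where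
  jj (u : F) : j (j u) = -u
  symm (u v : F) : B u v = B v u
  pos (u : F) : u ≠ 0 → 0 < B u u
  inv (u v : F) : B (j u) (j v) = B u v

namespace IsHermitianForm

variable {j : F →L[ℝ] F} {B : F →L[ℝ] F →L[ℝ] ℝ} (h : IsHermitianForm j B)
include h

lemma right (u v : F) : B u (j v) = -B (j u) v := by
  rw [← h.inv u (j v), h.jj, map_neg]

lemma self (u : F) : B (j u) u = 0 := by
  have h1 := h.right u u
  rw [h.symm] at h1
  linarith

lemma ext {u v : F} (huv : ∀ w, B u w = B v w) : u = v := by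
  by_contra hne
  have h1 := h.pos _ (sub_ne_zero.2 hne)
  rw [map_sub, h.symm _ u, h.symm _ v, huv, sub_self] at h1
  exact lt_irrefl _ h1

variable {D : F →L[ℝ] F →L[ℝ] F →L[ℝ] ℝ} {Γ : F → F → F} {θ : F →L[ℝ] ℝ}
  (hm : ∀ u v w, D u v w = B (Γ u v) w + B v (Γ u w))
  (hj : ∀ u v, Γ u (j v) = j (Γ u v))
  (hT : ∀ u v w, B (Γ u v - Γ v u) w = -B (Γ u w - Γ w u) v)
  (hθ : ∀ u v w, D u v (j w) + D v w (j u) + D w u (j v) =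
    θ u * B v (j w) + θ v * B w (j u) + θ w * B u (j v))
include hm hj hT hθ

/-- The torsion of the Bismut connection is `-dω(j·, j·, j·)`. -/
lemma torsion_eq (x y z : F) : B (Γ x y - Γ y x) z =
    θ (j x) * B (j y) z + θ (j y) * B (j z) x + θ (j z) * B (j x) y := by
  have hD : ∀ u v w, D u v (j w) = B (Γ u v) (j w) - B (Γ u w) (j v) := fun u v w => by
    rw [hm, hj, h.right v, h.symm (j v)]; ring
  have s : ∀ u v w, B (Γ u v - Γ v u) w = B (Γ u v) w - B (Γ v u) w := fun u v w => by simp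
  -- Since `∇ω = 0`, `dω(u, v, w)` is the cyclic sum of `ω(T(u, v), w)`.
  have hS : ∀ u v w, B (Γ u v - Γ v u) (j w) + B (Γ v w - Γ w v) (j u) + B (Γ w u - Γ u w) (j v) =
      θ u * B v (j w) + θ v * B w (j u) + θ w * B u (j v) := fun u v w => by
    rw [← hθ, hD, hD, hD, s, s, s]; ring
  have hN : B (Γ x y - Γ y x) z = B (Γ (j x) (j y) - Γ (j y) (j x)) z +
      B (Γ (j x) y - Γ y (j x)) (j z) + B (Γ x (j y) - Γ (j y) x) (j z) := by
    -- `hN` is the vanishing of the Nijenhuis tensor, written through the torsion of a connection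
    -- that preserves `j`.
    simp only [hj, map_sub, _root_.sub_apply, h.right, map_neg, _root_.neg_apply, h.jj]
    ring
  -- Total skewness identifies the right side of `hN` with the cyclic sum of `hS` at `(jx, jy, jz)`,
  -- up to sign.
  have a1 : B (Γ (j y) (j z) - Γ (j z) (j y)) x = B (Γ x (j y) - Γ (j y) x) (j z) := by
    rw [hT, s, s]; ring
  have a2 : B (Γ (j z) (j x) - Γ (j x) (j z)) y = B (Γ (j x) y - Γ y (j x)) (j z) := by
    have := hT (j x) (j z) y
    rw [s, s] at this ⊢
    linarith
  have e := hS (j x) (j y) (j z)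
  simp only [h.jj, map_neg, a1, a2] at e
  linarith

/-- In the combination `t1 + t2 - t3 + t4` of torsion values all derivatives along `y` and `jy`
cancel, as `Γ` commutes with `j` in its second argument. The (0,1)-part is thus read off from the
torsion. -/
lemma apply_christoffel_antiholomorphic (x y w : F) :
    B (Γ x y + j (Γ (j x) y)) w =
      θ x * B y w + θ (j x) * B (j y) w - B x y * θ w - B x (j y) * θ (j w) := by
  have t := h.torsion_eq hm hj hT hθ
  have t1 := t x y w
  have t2 := t (j x) (j y) w
  have t3 := t (j x) y (j w)
  have t4 := t x (j y) (j w)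
  have sw : ∀ u v, B (j u) v = -B (j v) u := fun u v => by rw [h.symm, h.right]
  simp only [hj, map_sub, _root_.sub_apply, h.right, h.jj, map_neg, _root_.neg_apply, map_add,
    _root_.add_apply, h.symm w x, h.symm w y, h.symm y x, sw w x, sw w y, sw y x]
    at t1 t2 t3 t4 ⊢
  linear_combination (t1 + t2 - t3 + t4) / 2

lemma christoffel_antiholomorphic {V : F} (hV : ∀ w, B V w = θ w) (x y : F) :
    Γ x y + j (Γ (j x) y) = θ x • y + θ (j x) • j y - B x y • V + B x (j y) • j V := by
  refine h.ext fun w => ?_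
  rw [h.apply_christoffel_antiholomorphic hm hj hT hθ]
  have hw := hV (j w)
  rw [h.right] at hw
  simp only [map_sub, _root_.sub_apply, map_add, _root_.add_apply, map_smul, _root_.smul_apply,
    smul_eq_mul, hV]
  linear_combination B x (j y) * hw

/-- A Koszul-type formula: the metric condition along `x` and `jx` determines the (1,0)-part once
the (0,1)-part is known. -/
lemma two_mul_christoffel (x y w : F) :
    2 * B (Γ x y) w = D x y w + D (j x) y (j w) - θ (j x) * B y (j w) + θ y * B x w
      + θ (j y) * B x (j w) + θ (j x) * B (j y) w - B x y * θ w - B x (j y) * θ (j w) := by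
  have n1 := h.apply_christoffel_antiholomorphic hm hj hT hθ x y w
  have n2 := h.apply_christoffel_antiholomorphic hm hj hT hθ x w y
  have d1 := hm x y w
  have d2 := hm (j x) y (j w)
  rw [hj, h.symm y, h.right] at d2
  rw [h.symm y] at d1
  rw [map_add, _root_.add_apply] at n1 n2
  rw [h.symm w y, ← h.symm y (j w)] at n2
  linear_combination n1 - d1 - d2 - n2

end IsHermitianForm
end pointwise

end

/-! ### Lee form and Bismut connection on an open subset of a vector space. -/

section

section localComputation

variable {F : Type*} [NormedAddCommGroup F] [NormedSpace ℝ F] [FiniteDimensional ℝ F]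

lemma IsHermitianForm.isInvertible {j : F →L[ℝ] F} {B : F →L[ℝ] F →L[ℝ] ℝ}
    (h : IsHermitianForm j B) : B.IsInvertible := by
  have hinj : Function.Injective (B : F →ₗ[ℝ] F →L[ℝ] ℝ) := fun u v huv =>
    h.ext fun w => congr($huv w)
  have hr : Module.finrank ℝ F = Module.finrank ℝ (F →L[ℝ] ℝ) := by
    rw [← (LinearMap.toContinuousLinearMap (𝕜 := ℝ) (E := F) (F' := ℝ)).finrank_eq]
    exact (Subspace.dual_finrank_eq (K := ℝ) (V := F)).symm
  exact ⟨(LinearMap.linearEquivOfInjective _ hinj hr).toContinuousLinearEquiv, by ext; rfl⟩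

lemma differentiableAt_clm_of_apply {l : F → F →L[ℝ] ℝ} {p : F}
    (hl : ∀ w, DifferentiableAt ℝ (fun q => l q w) p) : DifferentiableAt ℝ l p := by
  let b := Module.finBasis ℝ F
  have h1 : l = fun q => ∑ i, l q (b i) • (b.coord i).toContinuousLinearMap := by
    ext q w
    conv_lhs => rw [← b.sum_repr w, map_sum]
    simp only [map_smul, smul_eq_mul]
    simp [mul_comm]
  rw [h1]
  exact DifferentiableAt.fun_sum fun i _ => (hl (b i)).smul_const _

/-- Here `f` is the inverse of `G` applied to `l`, and inversion is smooth at an invertible map.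
This gives regularity of vectors known only through their pairings. -/
lemma IsHermitianForm.differentiableAt_of_apply {j : F →L[ℝ] F} {G : F → F →L[ℝ] F →L[ℝ] ℝ}
    {U : Set F} (hU : IsOpen U) {p : F} (hp : p ∈ U) (h : ∀ q ∈ U, IsHermitianForm j (G q))
    (hG : DifferentiableAt ℝ G p) {f : F → F} {l : F → F → ℝ}
    (hl : ∀ w, DifferentiableAt ℝ (fun q => l q w) p)
    (hfl : ∀ q ∈ U, ∀ w, G q (f q) w = l q w) : DifferentiableAt ℝ f p := by
  have : CompleteSpace F := FiniteDimensional.complete ℝ F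
  obtain ⟨e, he⟩ := (h p hp).isInvertible
  have h1 : DifferentiableAt ℝ (fun q => (G q).inverse) p := by
    have := (contDiffAt_map_inverse (𝕜 := ℝ) (n := 1) e).differentiableAt (by simp)
    rw [he] at this
    exact this.comp p hG
  have h2 : DifferentiableAt ℝ (fun q => G q (f q)) p :=
    differentiableAt_clm_of_apply fun w => (hl w).congr_of_eventuallyEq (by
      filter_upwards [hU.mem_nhds hp] with q hq using hfl q hq w)
  refine (h1.clm_apply h2).congr_of_eventuallyEq ?_
  filter_upwards [hU.mem_nhds hp] with q hq
  obtain ⟨e', he'⟩ := (h q hq).isInvertible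
  rw [← he', ContinuousLinearMap.inverse_equiv]
  simp

section
variable {j : F →L[ℝ] F} {G : F → F →L[ℝ] F →L[ℝ] ℝ} {U : Set F} (hU : IsOpen U) {p : F}
  (hp : p ∈ U) (h : ∀ q ∈ U, IsHermitianForm j (G q)) (hG : DifferentiableAt ℝ G p)
include hU hp h hG

lemma IsHermitianForm.fderiv_right (u v w : F) :
    fderiv ℝ G p u v (j w) = -fderiv ℝ G p u (j v) w := by
  have hd := hG.hasFDerivAt
  have h1 : HasFDerivAt (fun q => G q v (j w)) _ p :=
    (hd.clm_apply (hasFDerivAt_const v p)).clm_apply (hasFDerivAt_const (j w) p)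
  have h2 : HasFDerivAt (fun q => -G q (j v) w) _ p :=
    ((hd.clm_apply (hasFDerivAt_const (j v) p)).clm_apply (hasFDerivAt_const w p)).neg
  have h3 := h1.unique (h2.congr_of_eventuallyEq (by
    filter_upwards [hU.mem_nhds hp] with q hq using (h q hq).right v w))
  simpa using congr($h3 u)

lemma IsHermitianForm.fderiv_symm (u v w : F) : fderiv ℝ G p u v w = fderiv ℝ G p u w v := by
  have hd := hG.hasFDerivAt
  have h1 : HasFDerivAt (fun q => G q v w) _ p :=
    (hd.clm_apply (hasFDerivAt_const v p)).clm_apply (hasFDerivAt_const w p)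
  have h2 : HasFDerivAt (fun q => G q w v) _ p :=
    (hd.clm_apply (hasFDerivAt_const w p)).clm_apply (hasFDerivAt_const v p)
  have h3 := h1.unique (h2.congr_of_eventuallyEq (by
    filter_upwards [hU.mem_nhds hp] with q hq using (h q hq).symm v w))
  simpa using congr($h3 u)

end

variable (j : F →L[ℝ] F) (G : F → F →L[ℝ] F →L[ℝ] ℝ) (Θ : F → F →L[ℝ] ℝ) (U : Set F)

/-- A Hermitian metric with Lee form `Θ` on the open set `U`. -/
structure IsLocalLee : Prop where
  isOpen : IsOpen U
  herm : ∀ p ∈ U, IsHermitianForm j (G p)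
  smooth : ContDiffOn ℝ ∞ G U
  smooth_lee : ContDiffOn ℝ ∞ Θ U
  lee : ∀ p ∈ U, ∀ u v w, dFund j G p u v w =
    Θ p u * G p v (j w) + Θ p v * G p w (j u) + Θ p w * G p u (j v)

/-- The Christoffel symbols of a Bismut connection on the open set `U`. -/
structure IsLocalBismut (Γ : F → F → F → F) : Prop where
  metric : ∀ p ∈ U, ∀ u v w, fderiv ℝ G p u v w = G p (Γ p u v) w + G p v (Γ p u w)
  complex : ∀ p ∈ U, ∀ u v, Γ p u (j v) = j (Γ p u v)
  torsion : ∀ p ∈ U, ∀ u v w, G p (Γ p u v - Γ p v u) w = -G p (Γ p u w - Γ p w u) v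
  add : ∀ p ∈ U, ∀ u v w, Γ p u (v + w) = Γ p u v + Γ p u w
  neg_left : ∀ p ∈ U, ∀ u v, Γ p (-u) v = -Γ p u v

variable {j G Θ U} {Γ : F → F → F → F} (h : IsLocalLee j G Θ U)
include h

namespace IsLocalLee
variable {p : F} (hp : p ∈ U)
include hp

lemma contDiffAt : ContDiffAt ℝ ∞ G p := h.smooth.contDiffAt (h.isOpen.mem_nhds hp)
lemma contDiffAt_lee : ContDiffAt ℝ ∞ Θ p := h.smooth_lee.contDiffAt (h.isOpen.mem_nhds hp)
lemma differentiableAt : DifferentiableAt ℝ G p := (h.contDiffAt hp).differentiableAt (by simp)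
lemma differentiableAt_lee : DifferentiableAt ℝ Θ p :=
  (h.contDiffAt_lee hp).differentiableAt (by simp)

lemma fderiv_apply (u v w : F) : fderiv ℝ G p u v w = fderiv ℝ (fun q => G q v w) p u := by
  have hd := (h.differentiableAt hp).hasFDerivAt
  have h1 : HasFDerivAt (fun q => G q v w) _ p :=
    (hd.clm_apply (hasFDerivAt_const v p)).clm_apply (hasFDerivAt_const w p)
  rw [h1.fderiv]
  simp

lemma contDiffAt_apply (v w : F) : ContDiffAt ℝ ∞ (fun q => G q v w) p :=
  ((h.contDiffAt hp).clm_apply contDiffAt_const).clm_apply contDiffAt_const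

lemma differentiableAt_fderiv (v w : F) :
    DifferentiableAt ℝ (fderiv ℝ (fun q => G q v w)) p :=
  ((h.contDiffAt_apply hp v w).fderiv_right (m := ∞) (by simp)).differentiableAt (by simp)

lemma fderiv_right (u v w : F) : fderiv ℝ G p u v (j w) = -fderiv ℝ G p u (j v) w :=
  IsHermitianForm.fderiv_right h.isOpen hp h.herm (h.differentiableAt hp) u v w

lemma fderiv_symm (u v w : F) : fderiv ℝ G p u v w = fderiv ℝ G p u w v :=
  IsHermitianForm.fderiv_symm h.isOpen hp h.herm (h.differentiableAt hp) u v w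

/-- `d(dω) = 0` gives `dθ ∧ ω = 0`. -/
lemma dOne_wedge (a b c d : F) :
    dOne Θ p a b * G p c (j d) - dOne Θ p a c * G p b (j d) + dOne Θ p a d * G p b (j c)
      + dOne Θ p b c * G p a (j d) - dOne Θ p b d * G p a (j c) + dOne Θ p c d * G p a (j b) = 0 := by
  have hs : ∀ x y u v, fderiv ℝ (fderiv ℝ (fun q => G q x (j y))) p u v =
      fderiv ℝ (fderiv ℝ (fun q => G q x (j y))) p v u := fun x y =>
    (h.contDiffAt_apply hp x (j y)).isSymmSndFDerivAt (by
      simp only [minSmoothness_of_isRCLikeNormedField]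
      exact WithTop.coe_le_coe.2 (le_top : (2 : ℕ∞) ≤ ⊤))
  have hdd := fun v w => (h.differentiableAt_fderiv hp v w).hasFDerivAt
  have hd := (h.differentiableAt hp).hasFDerivAt
  have ht := (h.differentiableAt_lee hp).hasFDerivAt
  -- The identity `dω = θ ∧ ω`, valid on all of `U`, differentiated in the direction `s`.
  have key : ∀ s u v w : F,
      fderiv ℝ (fderiv ℝ (fun q => G q v (j w))) p s u +
      fderiv ℝ (fderiv ℝ (fun q => G q w (j u))) p s v +
      fderiv ℝ (fderiv ℝ (fun q => G q u (j v))) p s w =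
      fderiv ℝ Θ p s u * G p v (j w) + Θ p u * fderiv ℝ G p s v (j w) +
      (fderiv ℝ Θ p s v * G p w (j u) + Θ p v * fderiv ℝ G p s w (j u)) +
      (fderiv ℝ Θ p s w * G p u (j v) + Θ p w * fderiv ℝ G p s u (j v)) := by
    intro s u v w
    have e1 : ∀ u v w : F, HasFDerivAt (fun q => fderiv ℝ (fun q => G q v (j w)) q u) _ p :=
      fun u v w => (hdd v (j w)).clm_apply (hasFDerivAt_const u p)
    have e2 : ∀ u v w : F, HasFDerivAt (fun q => Θ q u * G q v (j w)) _ p := fun u v w =>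
      (ht.clm_apply (hasFDerivAt_const u p)).mul
      ((hd.clm_apply (hasFDerivAt_const v p)).clm_apply (hasFDerivAt_const (j w) p))
    have e3 := (((e1 u v w).add (e1 v w u)).add (e1 w u v)).unique
      ((((e2 u v w).add (e2 v w u)).add (e2 w u v)).congr_of_eventuallyEq (by
        filter_upwards [h.isOpen.mem_nhds hp] with q hq
        have := h.lee q hq u v w
        simp only [dFund, h.fderiv_apply hq] at this
        exact this))
    have e4 := congr($e3 s)
    simp at e4
    linear_combination e4
  have k1 := key a b c d
  have k2 := key b a c d
  have k3 := key c a b d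
  have k4 := key d a b c
  have l1 := h.lee p hp b c d
  have l2 := h.lee p hp a c d
  have l3 := h.lee p hp a b d
  have l4 := h.lee p hp a b c
  have sw : ∀ u v, G p u (j v) = -G p v (j u) := fun u v => by
    rw [(h.herm p hp).right, (h.herm p hp).symm]
  have sw2 : ∀ s u v, fderiv ℝ G p s u (j v) = -fderiv ℝ G p s v (j u) := fun s u v => by
    rw [h.fderiv_right hp, h.fderiv_symm hp]
  have sw3 : ∀ s t u v, fderiv ℝ (fderiv ℝ (fun q => G q u (j v))) p s t =
      -fderiv ℝ (fderiv ℝ (fun q => G q v (j u))) p s t := by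
    intro s t u v
    have e3 := (hdd u (j v)).unique ((hdd v (j u)).neg.congr_of_eventuallyEq (by
      filter_upwards [h.isOpen.mem_nhds hp] with q hq
      ext r
      have e := h.fderiv_apply hq r u (j v)
      rw [h.fderiv_right hq, h.fderiv_symm hq, h.fderiv_apply hq] at e
      exact e.symm))
    simpa using congr($e3 s t)
  simp only [dFund, dOne, hs _ _ b a, hs _ _ c a, hs _ _ d a, hs _ _ c b, hs _ _ d b, hs _ _ d c,
    sw b a, sw c a, sw d a, sw c b, sw d b, sw d c,
    sw2 _ b a, sw2 _ c a, sw2 _ d a, sw2 _ c b, sw2 _ d b, sw2 _ d c,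
    sw3 _ _ b a, sw3 _ _ c a, sw3 _ _ d a, sw3 _ _ c b, sw3 _ _ d b,
    sw3 _ _ d c] at k1 k2 k3 k4 l1 l2 l3 l4 ⊢
  -- Alternating over the four directions cancels the second derivatives of `G`; the remaining `θ ∧
  -- dω` is `θ ∧ θ ∧ ω = 0` by `l1` to `l4`.
  linear_combination -k1 + k2 - k3 + k4 + Θ p a * l1 - Θ p b * l2 + Θ p c * l3 - Θ p d * l4

end IsLocalLee

namespace IsLocalBismut
variable (hΓ : IsLocalBismut j G U Γ)
include hΓ

/-- The Bismut conditions force regularity: by `two_mul_christoffel` the symbols are determined by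
the metric, its first derivatives and the Lee form. -/
lemma differentiableAt {p : F} (hp : p ∈ U) (u v : F) : DifferentiableAt ℝ (fun q => Γ q u v) p := by
  have hd := h.differentiableAt hp
  have hdd := fun u v w => (h.differentiableAt_fderiv hp v w).clm_apply (differentiableAt_const u)
  have ht := h.differentiableAt_lee hp
  refine IsHermitianForm.differentiableAt_of_apply h.isOpen hp h.herm hd (l := fun q w => (1 / 2 : ℝ) *
    (fderiv ℝ (fun q => G q v w) q u + fderiv ℝ (fun q => G q v (j w)) q (j u)
      - Θ q (j u) * G q v (j w) + Θ q v * G q u w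
      + Θ q (j v) * G q u (j w) + Θ q (j u) * G q (j v) w - G q u v * Θ q w
      - G q u (j v) * Θ q (j w))) ?_ ?_
  · intro w
    have h1 := hdd u v w
    have h2 := hdd (j u) v (j w)
    fun_prop
  · intro q hq w
    have := (h.herm q hq).two_mul_christoffel (hΓ.metric q hq) (hΓ.complex q hq) (hΓ.torsion q hq)
      (h.lee q hq) u v w
    rw [h.fderiv_apply hq, h.fderiv_apply hq] at this
    linear_combination this / 2

end IsLocalBismut
end localComputation

end

/-! ### The (0,2)-part of the curvature and of the differential of the Lee form. -/

section

section localCurvature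

variable {F : Type*} [NormedAddCommGroup F] [NormedSpace ℝ F] [FiniteDimensional ℝ F]
  {j : F →L[ℝ] F} {G : F → F →L[ℝ] F →L[ℝ] ℝ} {Θ : F → F →L[ℝ] ℝ} {U : Set F}
  {Γ : F → F → F → F}

/-- The vector field dual to the Lee form. -/
def leeField (G : F → F →L[ℝ] F →L[ℝ] ℝ) (Θ : F → F →L[ℝ] ℝ) (p : F) : F := (G p).inverse (Θ p)

/-- The `(0,1)`-part of the Bismut connection. -/
def antiholomorphicPart (j : F →L[ℝ] F) (G : F → F →L[ℝ] F →L[ℝ] ℝ) (Θ : F → F →L[ℝ] ℝ)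
    (x y p : F) : F :=
  Θ p x • y + Θ p (j x) • j y - G p x y • leeField G Θ p + G p x (j y) • j (leeField G Θ p)

namespace IsLocalLee
variable (h : IsLocalLee j G Θ U) {p : F} (hp : p ∈ U)
include h hp

lemma apply_leeField (w : F) : G p (leeField G Θ p) w = Θ p w := by
  obtain ⟨e, he⟩ := (h.herm p hp).isInvertible
  rw [leeField, ← he, ContinuousLinearMap.inverse_equiv]
  simp

lemma differentiableAt_leeField : DifferentiableAt ℝ (leeField G Θ) p :=
  IsHermitianForm.differentiableAt_of_apply h.isOpen hp h.herm (h.differentiableAt hp)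
    (l := fun q w => Θ q w)
    (fun w => (h.differentiableAt_lee hp).clm_apply (differentiableAt_const w))
    (fun _ hq w => h.apply_leeField hq w)

lemma fderiv_leeField (u w : F) :
    G p (fderiv ℝ (leeField G Θ) p u) w = fderiv ℝ Θ p u w - fderiv ℝ G p u (leeField G Θ p) w := by
  have h1 := ((h.differentiableAt hp).hasFDerivAt.clm_apply
    (h.differentiableAt_leeField hp).hasFDerivAt).clm_apply (hasFDerivAt_const w p)
  have h2 := (h.differentiableAt_lee hp).hasFDerivAt.clm_apply (hasFDerivAt_const w p)
  have h3 := congr($(h1.unique (h2.congr_of_eventuallyEq (by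
    filter_upwards [h.isOpen.mem_nhds hp] with q hq using h.apply_leeField hq w))) u)
  simp at h3
  linarith

lemma fderiv_antiholomorphicPart (x y u : F) : fderiv ℝ (antiholomorphicPart j G Θ x y) p u =
    fderiv ℝ Θ p u x • y + fderiv ℝ Θ p u (j x) • j y
    - (fderiv ℝ G p u x y • leeField G Θ p + G p x y • fderiv ℝ (leeField G Θ) p u)
    + (fderiv ℝ G p u x (j y) • j (leeField G Θ p)
      + G p x (j y) • j (fderiv ℝ (leeField G Θ) p u)) := by
  have hv := (h.differentiableAt_leeField hp).hasFDerivAt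
  have hd := (h.differentiableAt hp).hasFDerivAt
  have ht := (h.differentiableAt_lee hp).hasFDerivAt
  have e1 := fun x => ht.clm_apply (hasFDerivAt_const x p)
  have e2 := fun x y => (hd.clm_apply (hasFDerivAt_const x p)).clm_apply (hasFDerivAt_const y p)
  have e3 := ((((e1 x).smul_const y).add ((e1 (j x)).smul_const (j y))).sub
    ((e2 x y).smul hv)).add ((e2 x (j y)).smul (j.hasFDerivAt.comp p hv))
  have e4 : HasFDerivAt (antiholomorphicPart j G Θ x y) _ p := e3
  rw [e4.fderiv]
  simp
  abel

end IsLocalLee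

namespace IsLocalBismut
variable (h : IsLocalLee j G Θ U) (hΓ : IsLocalBismut j G U Γ) {p : F} (hp : p ∈ U)
include h hΓ hp

lemma antiholomorphicPart_eq (x y : F) :
    Γ p x y + j (Γ p (j x) y) = antiholomorphicPart j G Θ x y p :=
  (h.herm p hp).christoffel_antiholomorphic (hΓ.metric p hp) (hΓ.complex p hp) (hΓ.torsion p hp)
      (h.lee p hp) (h.apply_leeField hp) x y

variable (hR : ∀ u v w : F,
    fderiv ℝ (fun q => Γ q v w) p u + Γ p u (Γ p v w)
      - (fderiv ℝ (fun q => Γ q u w) p v + Γ p v (Γ p u w)) =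
    fderiv ℝ (fun q => Γ q (j v) w) p (j u) + Γ p (j u) (Γ p (j v) w)
      - (fderiv ℝ (fun q => Γ q (j u) w) p (j v) + Γ p (j v) (Γ p (j u) w)))
include hR

/-- The `(0,2)`-part of the curvature vanishes. -/
lemma antiholomorphic_flat (x y z : F) :
    fderiv ℝ (antiholomorphicPart j G Θ y z) p x + j (fderiv ℝ (antiholomorphicPart j G Θ y z) p (j x))
      - (fderiv ℝ (antiholomorphicPart j G Θ x z) p y
        + j (fderiv ℝ (antiholomorphicPart j G Θ x z) p (j y)))
      + antiholomorphicPart j G Θ x (antiholomorphicPart j G Θ y z p) p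
      - antiholomorphicPart j G Θ y (antiholomorphicPart j G Θ x z p) p = 0 := by
  have hjj := (h.herm p hp).jj
  have hneg : ∀ v, Γ p v 0 = 0 := fun v => by simpa using hΓ.add p hp v 0 0
  have hneg' : ∀ v w, Γ p v (-w) = -Γ p v w := fun v w => by
    rw [eq_neg_iff_add_eq_zero, ← hΓ.add p hp, neg_add_cancel, hneg]
  have e1 : ∀ y z u, fderiv ℝ (antiholomorphicPart j G Θ y z) p u =
      fderiv ℝ (fun q => Γ q y z) p u + j (fderiv ℝ (fun q => Γ q (j y) z) p u) := by
    intro y z u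
    have h1 := (hΓ.differentiableAt h hp y z).hasFDerivAt.add
      (j.hasFDerivAt.comp p (hΓ.differentiableAt h hp (j y) z).hasFDerivAt)
    have h2 : antiholomorphicPart j G Θ y z =ᶠ[𝓝 p]
        ((fun q => Γ q y z) + j ∘ fun q => Γ q (j y) z) := by
      filter_upwards [h.isOpen.mem_nhds hp] with q hq using (hΓ.antiholomorphicPart_eq h hq y z).symm
    rw [h2.fderiv_eq]
    exact congr($(h1.fderiv) u)
  have e2 : ∀ y z u, fderiv ℝ (fun q => Γ q (-y) z) p u = - fderiv ℝ (fun q => Γ q y z) p u := by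
    intro y z u
    have h2 : (fun q => Γ q (-y) z) =ᶠ[𝓝 p] fun q => -Γ q y z := by
      filter_upwards [h.isOpen.mem_nhds hp] with q hq using hΓ.neg_left q hq y z
    rw [h2.fderiv_eq, fderiv_fun_neg]
    rfl
  -- The (0,2)-component is `R(x,y) - R(jx,jy) + j(R(jx,y) + R(x,jy))`. The hypothesis at `(x, y)`
  -- kills the first half, at `(jx, y)` the second.
  have r1 := hR x y z
  have r2 := congrArg j (hR (j x) y z)
  simp only [← hΓ.antiholomorphicPart_eq h hp, e1, hjj, e2, hΓ.add p hp, hΓ.neg_left p hp,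
    hΓ.complex p hp, map_add, map_sub, map_neg, hneg'] at r1 r2 ⊢
  rw [← sub_eq_zero] at r1 r2
  rw [← add_zero (0 : F)]
  nth_rewrite 1 [← r1]
  rw [← r2]
  abel

/-- On Hermitian-orthogonal vectors, the `(0,2)`-part of `dθ` vanishes. -/
lemma dOne_eq_dOne_of_orthogonal {x y : F} (hx : x ≠ 0) (hy : y ≠ 0) (hxy : G p x y = 0)
    (hxy' : G p (j x) y = 0) : dOne Θ p x y = dOne Θ p (j x) (j y) := by
  have H := h.herm p hp
  have hjj := H.jj
  have hV := h.apply_leeField hp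
  have hdV := h.fderiv_leeField hp
  have sw : ∀ u v, G p (j u) v = -G p (j v) u := fun u v => by rw [H.symm, H.right]
  have hyx : G p y x = 0 := by rw [H.symm, hxy]
  have hyx' : G p (j y) x = 0 := by rw [sw, hxy', neg_zero]
  have hVj : ∀ u, G p (j (leeField G Θ p)) u = -Θ p (j u) := fun u => by
    rw [sw, ← hV, H.symm]
  have hVr : ∀ u, G p u (leeField G Θ p) = Θ p u := fun u => by rw [H.symm, hV]
  have fr := h.fderiv_right hp
  have fs := h.fderiv_symm hp
  have fsw : ∀ s u v, fderiv ℝ G p s (j u) v = -fderiv ℝ G p s (j v) u := fun s u v => by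
    rw [fs, fr]
  have fself : ∀ s u, fderiv ℝ G p s (j u) u = 0 := fun s u => by
    have := fsw s u u; linarith
  -- the compatibility of the Lee form with the derivative of the metric
  have A : ∀ z, fderiv ℝ G p x y z + fderiv ℝ G p (j x) y (j z) -
      fderiv ℝ G p y x z - fderiv ℝ G p (j y) x (j z) =
      Θ p x * G p y z - Θ p y * G p x z + Θ p (j y) * G p (j x) z - Θ p (j x) * G p (j y) z := by
    intro z
    have l1 := h.lee p hp (j x) y z
    have l2 := h.lee p hp (j y) x z
    simp only [dFund, hjj, fr, H.right, map_neg, _root_.neg_apply, hxy, hyx, hxy', hyx', H.self,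
      H.symm z x, H.symm z y, fs _ z x, fs _ z y, fsw z y x, fsw _ z x, fsw _ z y] at l1 l2 ⊢
    linear_combination l1 - l2 + fs z y x
  have hdV' : ∀ s u, G p (j s) (fderiv ℝ (leeField G Θ) p u) =
      fderiv ℝ Θ p u (j s) + fderiv ℝ G p u (j (leeField G Θ p)) s := fun s u => by
    rw [H.symm, hdV, fr]; ring
  have flat := hΓ.antiholomorphic_flat h hp hR x y
  -- Two diagonal components of the flatness equation suffice: its action on `x` paired with `x`,
  -- and on `y` paired with `y`.
  have F1 := congrArg (G p · x) (flat x)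
  have F2 := congrArg (G p · y) (flat y)
  have A1 := A x
  have A2 := A y
  have A3 := A (j x)
  have A4 := A (j y)
  -- At the Lee field the right side of `A` cancels identically, so `A5` removes the metric
  -- derivatives left in `f1 + f2`.
  have A5 := A (leeField G Θ p)
  simp only [h.fderiv_antiholomorphicPart hp, antiholomorphicPart, map_add, map_sub, map_smul,
    _root_.add_apply, _root_.sub_apply, _root_.smul_apply, smul_eq_mul, map_zero,
    _root_.zero_apply, hjj, map_neg, _root_.neg_apply, smul_neg, fr, fself,
    H.right, H.self, hxy, hyx, hxy', hyx', hV, hVj, hVr, H.inv, sw _ x, sw _ y, dOne,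
    sw (fderiv ℝ (leeField G Θ) p _), hdV, hdV', mul_zero, zero_mul, neg_zero, add_zero, zero_add, sub_zero, zero_sub, neg_neg, fs _ y x, fsw _ y x] at F1 F2 A1 A2 A3 A4 A5 ⊢
  rw [fs _ (leeField G Θ p) x, fsw _ (leeField G Θ p) x] at F1
  rw [fs _ (leeField G Θ p) y, fsw _ (leeField G Θ p) y] at F2
  -- Terms where `θ(x)` or `θ(jx)` multiplies a derivative of the metric are absorbed by `A1` and
  -- `A3`; what is left is a multiple of `G p x x`.
  have f1 : fderiv ℝ Θ p x y - fderiv ℝ Θ p (j x) (j y) - fderiv ℝ G p y x (leeField G Θ p)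
      + fderiv ℝ G p (j y) (j x) (leeField G Θ p) = 0 :=
    mul_left_cancel₀ (H.pos x hx).ne' (by linear_combination F1 + Θ p x * A1 + Θ p (j x) * A3)
  have f2 : fderiv ℝ G p x y (leeField G Θ p) - fderiv ℝ G p (j x) (j y) (leeField G Θ p)
      - fderiv ℝ Θ p y x + fderiv ℝ Θ p (j y) (j x) = 0 :=
    mul_left_cancel₀ (H.pos y hy).ne' (by linear_combination F2 + Θ p y * A2 + Θ p (j y) * A4)
  linear_combination f1 + f2 - A5

end IsLocalBismut
end localCurvature

end

/-! ### Sign of the square of a primitive (1,1)-form. -/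

section

/-- The wedge product of two `2`-forms. -/
def wedge {F : Type*} (A B : F → F → ℝ) (a b c d : F) : ℝ :=
  A a b * B c d - A a c * B b d + A a d * B b c + A b c * B a d - A b d * B a c + A c d * B a b

section pfaffian

variable {F : Type*} [NormedAddCommGroup F] [NormedSpace ℝ F] {j : F →L[ℝ] F}
  {B A : F →L[ℝ] F →L[ℝ] ℝ}

lemma IsHermitianForm.exists_orthogonal (H : IsHermitianForm j B) {c d : F} (hc : c ≠ 0) :
    ∃ s t : ℝ, B c (d - s • c - t • j c) = 0 ∧ B (j c) (d - s • c - t • j c) = 0 := by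
  have h := (H.pos c hc).ne'
  refine ⟨B c d / B c c, B (j c) d / B c c, ?_, ?_⟩
  · simp [H.right, H.self, h]
  · simp [H.inv, H.self, h]

/-- A primitive `2`-form without `(0,2)`-part has nonpositive Pfaffian. -/
lemma IsHermitianForm.wedge_self_nonpos (H : IsHermitianForm j B) (hA : ∀ u, A u u = 0)
    (hprim : ∀ a b c d, wedge (fun u v => A u v) (fun u v => B u (j v)) a b c d = 0)
    (hort : ∀ x y, x ≠ 0 → y ≠ 0 → B x y = 0 → B (j x) y = 0 → A x y = A (j x) (j y))
    {c d : F} (hc : c ≠ 0) (hd : ∀ s t : ℝ, d - s • c - t • j c ≠ 0) :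
    wedge (fun u v => A u v) (fun u v => A u v) c (j c) d (j d) ≤ 0 ∧
    (wedge (fun u v => A u v) (fun u v => A u v) c (j c) d (j d) = 0 →
      A c (j c) = 0 ∧ A c d = 0 ∧ A c (j d) = 0 ∧ A (j c) d = 0 ∧ A (j c) (j d) = 0 ∧
        A d (j d) = 0) := by
  have sw : ∀ u v, A u v = -A v u := fun u v => by
    have := hA (u + v); simp [hA] at this; linarith
  -- The value of `A ∧ A` on `(c, jc, d, jd)` does not change when `d` is replaced by its component
  -- `y` orthogonal to the complex line of `c`.
  obtain ⟨s, t, h1, h2⟩ := H.exists_orthogonal (d := d) hc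
  have hy := hd s t
  set y := d - s • c - t • j c with hy'
  have hdy : d = y + s • c + t • j c := by rw [hy']; abel
  clear_value y
  have hjj := H.jj
  have e1 := hort c y hc hy h1 h2
  have hjy : j y ≠ 0 := fun h => hy (by simpa [h] using (hjj y).symm)
  have e2 := hort c (j y) hc hjy (by rw [H.right, h2, neg_zero]) (by rw [H.inv, h1])
  -- On the orthogonal frame, primitivity reads `A(c,jc) B(y,y) + A(y,jy) B(c,c) = 0`.
  have e3 := hprim c (j c) y (j y)
  have a := H.pos c hc
  have b := H.pos y hy
  rw [hjj, map_neg] at e2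
  have h1' : B y c = 0 := by rw [H.symm, h1]
  have h2' : B (j c) (j y) = 0 := by rw [H.inv, h1]
  have h3' : B c (j y) = 0 := by rw [H.right, h2, neg_zero]
  simp only [wedge, hjj, map_neg, H.inv, h1, h2, h3', mul_neg, mul_zero, neg_zero, sub_zero,
    add_zero, H.right c y] at e3
  -- With `A(jc,jy) = A(c,y)`, `A(jc,y) = -A(c,jy)` and `e3`, every product in the Pfaffian becomes
  -- minus a square.
  have key : B c c * wedge (fun u v => A u v) (fun u v => A u v) c (j c) d (j d) =
      -2 * (B y y * A c (j c) ^ 2 + B c c * A c y ^ 2 + B c c * A c (j y) ^ 2) := by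
    subst hdy
    simp only [wedge, map_add, map_smul, _root_.add_apply, _root_.smul_apply, smul_eq_mul,
      hjj, map_neg, hA, sw y (j y), sw y c, sw (j c) c, sw y (j c), sw (j y) (j c), sw (j y) c, smul_neg,
      _root_.neg_apply]
    rw [← e1, e2]
    linear_combination (-2 * A c (j c)) * e3 - 2 * B c c * A c (j c) * sw y (j y)
  refine ⟨?_, fun h0 => ?_⟩
  · refine nonpos_of_mul_nonpos_right (key.le.trans ?_) a
    have : 0 ≤ B y y * A c (j c) ^ 2 + B c c * A c y ^ 2 + B c c * A c (j y) ^ 2 := by positivity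
    linarith
  · rw [h0, mul_zero] at key
    have k1 : 0 ≤ B y y * A c (j c) ^ 2 := by positivity
    have k2 : 0 ≤ B c c * A c y ^ 2 := by positivity
    have k3 : 0 ≤ B c c * A c (j y) ^ 2 := by positivity
    have l1 : A c (j c) = 0 := by
      have : B y y * A c (j c) ^ 2 = 0 := by linarith
      simpa [b.ne'] using this
    have l2 : A c y = 0 := by
      have : B c c * A c y ^ 2 = 0 := by linarith
      simpa [a.ne'] using this
    have l3 : A c (j y) = 0 := by
      have : B c c * A c (j y) ^ 2 = 0 := by linarith
      simpa [a.ne'] using this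
    have l4 : A y (j y) = 0 := by simpa [l1, a.ne'] using e3
    rw [l3, eq_comm, neg_eq_zero] at e2
    rw [l2, eq_comm] at e1
    subst hdy
    simp [hA, hjj, l1, l2, l3, l4, e1, e2, sw (j c) c, sw y c, sw (j y) c, sw y (j c)]

end pfaffian

section complexBasis

variable {E : Type*} [NormedAddCommGroup E] [NormedSpace ℂ E]

/-- The real basis `(b₀, i b₀, b₁, i b₁)`. -/
def realBasis (b : Module.Basis (Fin 2) ℂ E) : Module.Basis (Fin 4) ℝ E :=
  (Complex.basisOneI.smulTower b).reindex ((Equiv.prodComm (Fin 2) (Fin 2)).trans finProdFinEquiv)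

lemma coe_realBasis (b : Module.Basis (Fin 2) ℂ E) :
    ⇑(realBasis b) = ![b 0, mulI E (b 0), b 1, mulI E (b 1)] := by
  have e : ∀ i k : Fin 2, realBasis b (finProdFinEquiv (i, k)) = Complex.basisOneI k • b i := by
    intro i k
    simp [realBasis, Module.Basis.smulTower_apply]
  funext i
  fin_cases i
  · exact (e 0 0).trans (by simp)
  · exact (e 0 1).trans (by simp)
  · exact (e 1 0).trans (by simp)
  · exact (e 1 1).trans (by simp)

lemma eq_zero_of_realBasis (b : Module.Basis (Fin 2) ℂ E) {A : E →L[ℝ] E →L[ℝ] ℝ}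
    (hA : ∀ u, A u u = 0)
    (h : A (b 0) (mulI E (b 0)) = 0 ∧ A (b 0) (b 1) = 0 ∧ A (b 0) (mulI E (b 1)) = 0 ∧
      A (mulI E (b 0)) (b 1) = 0 ∧ A (mulI E (b 0)) (mulI E (b 1)) = 0 ∧
        A (b 1) (mulI E (b 1)) = 0) (u v : E) : A u v = 0 := by
  have sw : ∀ u v, A u v = -A v u := fun u v => by
    have := hA (u + v); simp [hA] at this; linarith
  obtain ⟨h1, h2, h3, h4, h5, h6⟩ := h
  have key : ∀ i k : Fin 4, A (realBasis b i) (realBasis b k) = 0 := by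
    intro i k
    rw [coe_realBasis]
    have g1 := sw (mulI E (b 0)) (b 0)
    have g2 := sw (b 1) (b 0)
    have g3 := sw (mulI E (b 1)) (b 0)
    have g4 := sw (b 1) (mulI E (b 0))
    have g5 := sw (mulI E (b 1)) (mulI E (b 0))
    have g6 := sw (mulI E (b 1)) (b 1)
    simp only [h1, h2, h3, h4, h5, h6, neg_zero] at g1 g2 g3 g4 g5 g6
    fin_cases i <;> fin_cases k <;> first | exact hA _ | assumption
  rw [← (realBasis b).sum_repr u, ← (realBasis b).sum_repr v]
  simp only [map_sum, _root_.sum_apply, map_smul, _root_.smul_apply, key, smul_zero,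
    Finset.sum_const_zero]

lemma basis_one_sub_ne_zero (b : Module.Basis (Fin 2) ℂ E) (s t : ℝ) :
    b 1 - s • b 0 - t • mulI E (b 0) ≠ 0 := by
  intro h
  have h1 : b.repr (b 1 - (s : ℂ) • b 0 - (t * Complex.I) • b 0) 1 = 1 := by
    rw [map_sub, map_sub, map_smul, map_smul]; simp
  have h2 : b 1 - (s : ℂ) • b 0 - (t * Complex.I) • b 0 = 0 := by
    rw [← h, mul_smul]; rfl
  have h3 : b 1 - (s : ℂ) • b 0 - ((t : ℂ) * Complex.I) • b 0 = 0 := h2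
  rw [h3] at h1
  simp at h1

variable [FiniteDimensional ℂ E] {G : E → E →L[ℝ] E →L[ℝ] ℝ} {Θ : E → E →L[ℝ] ℝ} {U : Set E}
  {Γ : E → E → E → E}

/-- The square of `dθ` is nonpositive, and vanishes only where `dθ` does. -/
lemma IsLocalBismut.wedge_dOne_nonpos (h : IsLocalLee (mulI E) G Θ U)
    (hΓ : IsLocalBismut (mulI E) G U Γ) {p : E} (hp : p ∈ U) (b : Module.Basis (Fin 2) ℂ E)
    (hR : ∀ u v w : E,
      fderiv ℝ (fun q => Γ q v w) p u + Γ p u (Γ p v w)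
        - (fderiv ℝ (fun q => Γ q u w) p v + Γ p v (Γ p u w)) =
      fderiv ℝ (fun q => Γ q (mulI E v) w) p (mulI E u) + Γ p (mulI E u) (Γ p (mulI E v) w)
        - (fderiv ℝ (fun q => Γ q (mulI E u) w) p (mulI E v)
          + Γ p (mulI E v) (Γ p (mulI E u) w))) :
    wedge (dOne Θ p) (dOne Θ p) (b 0) (mulI E (b 0)) (b 1) (mulI E (b 1)) ≤ 0 ∧
    (wedge (dOne Θ p) (dOne Θ p) (b 0) (mulI E (b 0)) (b 1) (mulI E (b 1)) = 0 →
      ∀ u v, dOne Θ p u v = 0) := by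
  have : FiniteDimensional ℝ E := FiniteDimensional.complexToReal E
  have key := (h.herm p hp).wedge_self_nonpos (A := fderiv ℝ Θ p - (fderiv ℝ Θ p).flip)
    (fun u => by simp) (fun a b c d => h.dOne_wedge hp a b c d)
    (fun x y hx hy h1 h2 => hΓ.dOne_eq_dOne_of_orthogonal h hp hR hx hy h1 h2)
    (b.ne_zero 0) (basis_one_sub_ne_zero b)
  exact ⟨key.1, fun h0 u v => eq_zero_of_realBasis b (A := fderiv ℝ Θ p - (fderiv ℝ Θ p).flip)
    (fun u => by simp) (key.2 h0) u v⟩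

end complexBasis

section charts

variable {E : Type*} [NormedAddCommGroup E] [NormedSpace ℂ E] [FiniteDimensional ℂ E]
  {X : Type*} [TopologicalSpace X] [ChartedSpace E X] [IsManifold 𝓘(ℂ, E) ω X]
  {g : HermitianMetric E X} {cov : AffineConnection E X} {θ : OneForm E X}

lemma HermitianMetric.isHermitianForm_inChart (g : HermitianMetric E X) {a : X} {p : E}
    (hp : p ∈ (chartAt E a).target) : IsHermitianForm (mulI E) (g.inChart a p) where
  jj u := by simp [smul_smul]
  symm := inChart_symm g
  pos := inChart_pos hp g
  inv := inChart_mulI hp g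

lemma HermitianMetric.IsLeeFormOfSurface.isLocalLee (h : g.IsLeeFormOfSurface θ) (a : X) :
    IsLocalLee (mulI E) (g.inChart a) (θ.inChart a) (chartAt E a).target where
  isOpen := (chartAt E a).open_target
  herm _ hp := g.isHermitianForm_inChart hp
  smooth := g.contDiffOn_inChart a
  smooth_lee := h.1.contDiffOn_inChart a
  lee p hp u v w := by
    have hs := fun u : E => smoothAt_coordField (X := X) hp (f := fun _ => u) contDiffAt_const
    have h1 := h.2 _ _ _ _ (hs u) (hs v) (hs w)
    rw [g.extDerivFundForm_eq hp (hs u) (hs v) (hs w), components_coordField hp,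
      components_coordField hp, components_coordField hp] at h1
    rw [h1]
    have hc := fun u : E => (coordField_const_apply a ((chartAt E a).symm p) u)
    have hf : ∀ v w : E, g.fundForm ((chartAt E a).symm p) (ofChart a _ v) (ofChart a _ w) =
        g.inChart a p v (mulI E w) := fun v w => by
      rw [HermitianMetric.inChart_apply, ofChart_mulI (symm_mem_source hp)]; rfl
    simp only [hc, hf]
    rfl

lemma HermitianMetric.IsBismutConnection.isLocalBismut (h : g.IsBismutConnection cov) (a : X) :
    IsLocalBismut (mulI E) (g.inChart a) (chartAt E a).target (christoffel cov a) where
  metric _ hp := h.fderiv_inChart hp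
  complex _ hp := h.christoffel_mulI hp
  torsion _ hp := h.torsion_christoffel hp
  add _ hp := christoffel_add_right hp
  neg_left _ _ _ _ := map_neg _ _

lemma HermitianMetric.IsLeeFormOfSurface.wedge_dOne_nonpos (hθ : g.IsLeeFormOfSurface θ)
    (h : g.IsBismutConnection cov) (hR : g.CurvatureJInvariant cov)
    (b : Module.Basis (Fin 2) ℂ E) {a : X} {p : E} (hp : p ∈ (chartAt E a).target) :
    wedge (dOne (θ.inChart a) p) (dOne (θ.inChart a) p)
      (b 0) (mulI E (b 0)) (b 1) (mulI E (b 1)) ≤ 0 ∧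
    (wedge (dOne (θ.inChart a) p) (dOne (θ.inChart a) p)
      (b 0) (mulI E (b 0)) (b 1) (mulI E (b 1)) = 0 → ∀ u v, dOne (θ.inChart a) p u v = 0) := by
  have : FiniteDimensional ℝ E := FiniteDimensional.complexToReal E
  exact (h.isLocalBismut a).wedge_dOne_nonpos (hθ.isLocalLee a) hp b
    (HermitianMetric.CurvatureJInvariant.inChart hp hR
      ((h.isLocalBismut a).differentiableAt (hθ.isLocalLee a) hp))

end charts

end

/-! ### Pointwise Lefschetz isomorphism and local existence of the Lee form. -/

section

section alternating

variable {F : Type*} [NormedAddCommGroup F] [NormedSpace ℝ F]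

/-- An alternating trilinear function on `F`. -/
structure IsAltThree (δ : F → F → F → ℝ) : Prop where
  linear (v w : F) : IsLinearMap ℝ (fun u => δ u v w)
  cyclic (u v w : F) : δ u v w = δ v w u
  self (u v : F) : δ u u v = 0

namespace IsAltThree
variable {δ ε : F → F → F → ℝ} (h : IsAltThree δ)

lemma sub (hδ : IsAltThree δ) (hε : IsAltThree ε) : IsAltThree fun u v w => δ u v w - ε u v w where
  linear v w := ⟨fun _ _ => by rw [(hδ.linear v w).1, (hε.linear v w).1]; ring,
    fun _ _ => by rw [(hδ.linear v w).2, (hε.linear v w).2, smul_sub]⟩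
  cyclic u v w := by rw [hδ.cyclic, hε.cyclic]
  self u v := by rw [hδ.self, hε.self, sub_zero]

include h

lemma add_left (u u' v w : F) : δ (u + u') v w = δ u v w + δ u' v w := (h.linear v w).1 u u'
lemma smul_left (c : ℝ) (u v w : F) : δ (c • u) v w = c * δ u v w := (h.linear v w).2 c u
lemma add_mid (u v v' w : F) : δ u (v + v') w = δ u v w + δ u v' w := by
  rw [h.cyclic, h.add_left, ← h.cyclic u v w, ← h.cyclic u v' w]
lemma smul_mid (c : ℝ) (u v w : F) : δ u (c • v) w = c * δ u v w := by
  rw [h.cyclic, h.smul_left, ← h.cyclic]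
lemma add_right (u v w w' : F) : δ u v (w + w') = δ u v w + δ u v w' := by
  rw [h.cyclic, h.add_mid, ← h.cyclic u v w, ← h.cyclic u v w']
lemma smul_right (c : ℝ) (u v w : F) : δ u v (c • w) = c * δ u v w := by
  rw [h.cyclic, h.smul_mid, ← h.cyclic]
lemma swap (u v w : F) : δ u v w = -δ v u w := by
  have := h.self (u + v) w
  rw [h.add_left, h.add_mid, h.add_mid, h.self, h.self] at this
  linarith
lemma self_right (u v : F) : δ u v v = 0 := by rw [h.cyclic, h.self]
lemma self_mid (u v : F) : δ u v u = 0 := by rw [← h.cyclic, h.self]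
lemma perm {u v w : F} (h0 : δ u v w = 0) : δ v w u = 0 ∧ δ w u v = 0 ∧ δ v u w = 0 ∧
    δ u w v = 0 ∧ δ w v u = 0 := by
  refine ⟨by rw [← h.cyclic, h0], by rw [h.cyclic, h0], by rw [h.swap, h0, neg_zero], ?_, ?_⟩
  · rw [h.cyclic, h.swap, ← h.cyclic, h0, neg_zero]
  · rw [h.swap, ← h.cyclic, h0, neg_zero]

/-- Linearity is recorded in the first argument only; cyclic invariance rotates each argument into
that place. -/
lemma eq_zero_of_basis {ι : Type*} (b : Module.Basis ι ℝ F)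
    (h0 : ∀ i k l, δ (b i) (b k) (b l) = 0) (u v w : F) : δ u v w = 0 := by
  have ext : ∀ v w, (∀ i, δ (b i) v w = 0) → ∀ u, δ u v w = 0 := fun v w hi u => by
    have := b.ext (f₁ := (h.linear v w).mk' _) (f₂ := 0) (fun i => hi i)
    exact congr($this u)
  refine ext v w (fun i => ?_) u
  rw [h.cyclic]
  refine ext w (b i) (fun k => ?_) v
  rw [h.cyclic]
  exact ext (b i) (b k) (fun l => by rw [h.cyclic]; exact h0 i k l) w

end IsAltThree

/-- Up to order, the frame `(b₀, i b₀, b₁, i b₁)` has just four triples of distinct vectors. -/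
lemma IsAltThree.eq_zero_of_frame {E : Type*} [NormedAddCommGroup E] [NormedSpace ℂ E]
    {δ : E → E → E → ℝ} (h : IsAltThree δ) (b : Module.Basis (Fin 2) ℂ E)
    (h1 : δ (b 0) (mulI E (b 0)) (b 1) = 0) (h2 : δ (b 0) (mulI E (b 0)) (mulI E (b 1)) = 0)
    (h3 : δ (b 0) (b 1) (mulI E (b 1)) = 0) (h4 : δ (mulI E (b 0)) (b 1) (mulI E (b 1)) = 0)
    (u v w : E) : δ u v w = 0 := by
  refine h.eq_zero_of_basis (realBasis b) (fun i k l => ?_) u v w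
  rw [coe_realBasis]
  obtain ⟨_, _, _, _, _⟩ := h.perm h1
  obtain ⟨_, _, _, _, _⟩ := h.perm h2
  obtain ⟨_, _, _, _, _⟩ := h.perm h3
  obtain ⟨_, _, _, _, _⟩ := h.perm h4
  fin_cases i <;> fin_cases k <;> fin_cases l <;>
    first | exact h.self _ _ | exact h.self_right _ _ | exact h.self_mid _ _ | assumption

/-- The wedge product of a `1`-form with `B(·, j ·)`. -/
def wedgeFund (j : F →L[ℝ] F) (B : F →L[ℝ] F →L[ℝ] ℝ) (θ : F → ℝ) (u v w : F) : ℝ :=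
  θ u * B v (j w) + θ v * B w (j u) + θ w * B u (j v)

variable {j : F →L[ℝ] F} {B : F →L[ℝ] F →L[ℝ] ℝ}

lemma IsHermitianForm.isAltThree_wedgeFund (H : IsHermitianForm j B) {θ : F → ℝ}
    (hθ : IsLinearMap ℝ θ) : IsAltThree (wedgeFund j B θ) where
  linear v w := ⟨fun a b => by simp only [wedgeFund, hθ.1, map_add, _root_.add_apply]; ring,
    fun a b => by
      simp only [wedgeFund, hθ.2, map_smul, _root_.smul_apply, smul_eq_mul]; ring⟩
  cyclic u v w := by unfold wedgeFund; ring
  self u v := by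
    unfold wedgeFund
    rw [H.right u u, H.self, H.right v u, H.symm (j v), H.symm u]
    rw [H.symm (j v) u]
    ring

set_option synthInstance.maxHeartbeats 400000 in
lemma isAltThree_dFund [FiniteDimensional ℝ F] {U : Set F} (hU : IsOpen U) {p : F} (hp : p ∈ U)
    {G : F → F →L[ℝ] F →L[ℝ] ℝ} (h : ∀ q ∈ U, IsHermitianForm j (G q))
    (hG : DifferentiableAt ℝ G p) : IsAltThree (dFund j G p) where
  linear v w := ⟨fun a b => by simp only [dFund, map_add, _root_.add_apply]; ring,
    fun a b => by
      simp only [dFund, map_smul, _root_.smul_apply, smul_eq_mul]; ring⟩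
  cyclic u v w := by unfold dFund; ring
  self u v := by
    have fr := IsHermitianForm.fderiv_right hU hp h hG
    have fs := IsHermitianForm.fderiv_symm hU hp h hG
    have h1 := fr v u u
    have h2 := fs v (j u) u
    have h3 := fr u v u
    have h4 := fs u (j v) u
    unfold dFund
    linarith

end alternating

section lefschetz

variable {E : Type*} [NormedAddCommGroup E] [NormedSpace ℂ E] [FiniteDimensional ℂ E]
  {B : E →L[ℝ] E →L[ℝ] ℝ}

/-- The unique `θ` with `θ ∧ B(·, i ·) = η`, in terms of an orthogonal frame `x, y`. -/
def lefschetz (B : E →L[ℝ] E →L[ℝ] ℝ) (η : E → E → E → ℝ) (x y v : E) : ℝ :=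
  -(η v x (mulI E x) / B x x + η v y (mulI E y) / B y y)

lemma IsAltThree.isLinearMap_lefschetz {η : E → E → E → ℝ} (h : IsAltThree η) (x y : E) :
    IsLinearMap ℝ (lefschetz B η x y) :=
  ⟨fun u v => by unfold lefschetz; rw [h.add_left, h.add_left]; ring,
    fun c u => by unfold lefschetz; rw [h.smul_left, h.smul_left, smul_eq_mul]; ring⟩

lemma exists_basis_pair (b : Module.Basis (Fin 2) ℂ E) (s t : ℝ) :
    ∃ b' : Module.Basis (Fin 2) ℂ E, b' 0 = b 0 ∧ b' 1 = b 1 - s • b 0 - t • mulI E (b 0) := by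
  have hl : LinearIndependent ℂ ![b 0, b 1 - s • b 0 - t • mulI E (b 0)] := by
    rw [LinearIndependent.pair_iff]
    intro c d hcd
    have e : c • b 0 + d • (b 1 - s • b 0 - t • mulI E (b 0)) =
        (c - d * (s + t * Complex.I)) • b 0 + d • b 1 := by
      have h1 : s • b 0 = (s : ℂ) • b 0 := rfl
      have h2 : t • mulI E (b 0) = ((t : ℂ) * Complex.I) • b 0 := by rw [mul_smul]; rfl
      rw [h1, h2]
      module
    rw [e] at hcd
    have e1 := congrArg (fun u => b.repr u 1) hcd
    have e0 := congrArg (fun u => b.repr u 0) hcd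
    simp only [map_add, map_smul, Module.Basis.repr_self, map_zero, Finsupp.add_apply,
      Finsupp.smul_apply, Finsupp.single_apply, Finsupp.zero_apply] at e0 e1
    have hd : d = 0 := by simpa using e1
    subst hd
    exact ⟨by simpa using e0, rfl⟩
  refine ⟨basisOfLinearIndependentOfCardEqFinrank hl (by
    rw [Module.finrank_eq_card_basis b]), by simp, by simp⟩

/-- Evaluating `θ ∧ ω` on `(v, x, ix)` and `(v, y, iy)` for an orthogonal frame recovers `θ(v)`,
which is the formula in `lefschetz`. Both sides being alternating, four frame triples remain to be
compared. -/
lemma IsHermitianForm.eq_wedgeFund_lefschetz (H : IsHermitianForm (mulI E) B)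
    {η : E → E → E → ℝ} (h : IsAltThree η) (b : Module.Basis (Fin 2) ℂ E)
    (h1 : B (b 0) (b 1) = 0) (h2 : B (mulI E (b 0)) (b 1) = 0) (u v w : E) :
    η u v w = wedgeFund (mulI E) B (lefschetz B η (b 0) (b 1)) u v w := by
  have hx := (H.pos _ (b.ne_zero 0)).ne'
  have hy := (H.pos _ (b.ne_zero 1)).ne'
  have H2 := h.sub (H.isAltThree_wedgeFund (h.isLinearMap_lefschetz (B := B) (b 0) (b 1)))
  rw [← sub_eq_zero]
  have hjj := H.jj
  have h3 : B (b 0) (mulI E (b 1)) = 0 := by rw [H.right, h2, neg_zero]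
  have h1' : B (b 1) (b 0) = 0 := by rw [H.symm, h1]
  have h2' : B (b 1) (mulI E (b 0)) = 0 := by rw [H.symm, h2]
  have h3' : B (mulI E (b 1)) (b 0) = 0 := by rw [H.symm, h3]
  have s1 : B (b 0) (mulI E (b 0)) = 0 := by rw [H.symm, H.self]
  have s2 : B (b 1) (mulI E (b 1)) = 0 := by rw [H.symm, H.self]
  refine H2.eq_zero_of_frame b ?_ ?_ ?_ ?_ u v w
  · simp only [wedgeFund, lefschetz, hjj, map_neg, h.self, h.self_right, h.self_mid, h1, h2, h3,
      h1', h2', h3', s1, s2, H.inv, H.self]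
    rw [h.cyclic (b 1)]
    field_simp
    ring
  · simp only [wedgeFund, lefschetz, hjj, map_neg, h.self, h.self_right, h.self_mid, h1, h2, h3,
      h1', h2', h3', s1, s2, H.inv, H.self]
    rw [h.cyclic (mulI E (b 1))]
    field_simp
    ring
  · simp only [wedgeFund, lefschetz, hjj, map_neg, h.self, h.self_right, h.self_mid, h1, h2, h3,
      h1', h2', h3', s1, s2, H.inv, H.self]
    field_simp
    ring
  · simp only [wedgeFund, lefschetz, hjj, map_neg, h.self, h.self_right, h.self_mid, h1, h2, h3,
      h1', h2', h3', s1, s2, H.inv, H.self]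
    field_simp
    ring

lemma contDiffAt_dFund {U : Set E} (hU : IsOpen U) {G : E → E →L[ℝ] E →L[ℝ] ℝ} {j : E →L[ℝ] E}
    (hG : ContDiffOn ℝ ∞ G U) {p : E} (hp : p ∈ U) (u v w : E) :
    ContDiffAt ℝ ∞ (fun q => dFund j G q u v w) p := by
  have key : ∀ u v w, ContDiffAt ℝ ∞ (fun q => fderiv ℝ G q u v w) p := by
    intro u v w
    have h1 : ContDiffAt ℝ ∞ (fun q => G q v w) p :=
      ((hG.contDiffAt (hU.mem_nhds hp)).clm_apply contDiffAt_const).clm_apply contDiffAt_const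
    refine (((h1.fderiv_right (m := ∞) (by simp)).clm_apply
      (contDiffAt_const (c := u)))).congr_of_eventuallyEq ?_
    filter_upwards [hU.mem_nhds hp] with q hq
    have hd := ((hG.contDiffAt (hU.mem_nhds hq)).differentiableAt (by simp)).hasFDerivAt
    have h1 : HasFDerivAt (fun q => G q v w) _ q :=
      (hd.clm_apply (hasFDerivAt_const v q)).clm_apply (hasFDerivAt_const w q)
    rw [h1.fderiv]
    simp
  exact ((key _ _ _).add (key _ _ _)).add (key _ _ _)

/-- Local existence of the Lee form. -/
lemma exists_local_lee {U : Set E} (hU : IsOpen U) {G : E → E →L[ℝ] E →L[ℝ] ℝ}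
    (hG : ContDiffOn ℝ ∞ G U) (hH : ∀ p ∈ U, IsHermitianForm (mulI E) (G p))
    (b : Module.Basis (Fin 2) ℂ E) :
    ∃ Θ : E → E →L[ℝ] ℝ, ContDiffOn ℝ ∞ Θ U ∧
      ∀ p ∈ U, ∀ u v w, dFund (mulI E) G p u v w = wedgeFund (mulI E) (G p) (Θ p) u v w := by
  have : FiniteDimensional ℝ E := FiniteDimensional.complexToReal E
  -- Complex Gram–Schmidt on a constant basis: `y p` is orthogonal to the complex line of `b 0` and
  -- varies smoothly with `p`.
  let s := fun p => G p (b 0) (b 1) / G p (b 0) (b 0)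
  let t := fun p => G p (mulI E (b 0)) (b 1) / G p (b 0) (b 0)
  let y := fun p => b 1 - s p • b 0 - t p • mulI E (b 0)
  have hdiff : ∀ p ∈ U, DifferentiableAt ℝ G p := fun p hp =>
    (hG.contDiffAt (hU.mem_nhds hp)).differentiableAt (by simp)
  have halt := fun p hp => isAltThree_dFund hU hp hH (hdiff p hp)
  have hex : ∀ p, ∃ L : E →L[ℝ] ℝ, p ∈ U →
      ∀ v, L v = lefschetz (G p) (dFund (mulI E) G p) (b 0) (y p) v := by
    intro p
    by_cases hp : p ∈ U
    · exact ⟨((halt p hp).isLinearMap_lefschetz (B := G p) (b 0) (y p)).mk' _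
        |>.toContinuousLinearMap, fun _ v => rfl⟩
    · exact ⟨0, fun h => absurd h hp⟩
  choose Θ hΘ using hex
  have ha : ∀ p ∈ U, G p (b 0) (b 0) ≠ 0 := fun p hp => ((hH p hp).pos _ (b.ne_zero 0)).ne'
  refine ⟨Θ, ?_, fun p hp u v w => ?_⟩
  · rw [contDiffOn_clm_apply]
    intro v p hp
    refine ContDiffAt.contDiffWithinAt ?_
    have hGp := hG.contDiffAt (hU.mem_nhds hp)
    have hd := fun u v w => contDiffAt_dFund hU (j := mulI E) hG hp u v w
    have hg : ∀ v w, ContDiffAt ℝ ∞ (fun q => G q v w) p := fun v w =>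
      (hGp.clm_apply contDiffAt_const).clm_apply contDiffAt_const
    have hs : ContDiffAt ℝ ∞ s p := (hg _ _).div (hg _ _) (ha p hp)
    have ht : ContDiffAt ℝ ∞ t p := (hg _ _).div (hg _ _) (ha p hp)
    have hy : ContDiffAt ℝ ∞ y p :=
      (contDiffAt_const.sub (hs.smul contDiffAt_const)).sub (ht.smul contDiffAt_const)
    have hyy : G p (y p) (y p) ≠ 0 := ((hH p hp).pos _ (basis_one_sub_ne_zero b _ _)).ne'
    have hyd : ContDiffAt ℝ ∞ (fun q => dFund (mulI E) G q v (y q) (mulI E (y q))) p := by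
      let s' := fun q => -s q
      let t' := fun q => -t q
      have hs' : ContDiffAt ℝ ∞ s' p := hs.neg
      have ht' : ContDiffAt ℝ ∞ t' p := ht.neg
      -- Smoothness of `dFund` is available for constant arguments, so the moving vector `y q` is
      -- expanded multilinearly into constant ones.
      have e : (fun q => dFund (mulI E) G q v (y q) (mulI E (y q))) =ᶠ[𝓝 p] fun q =>
          dFund (mulI E) G q v (b 1) (mulI E (b 1)) + s' q * dFund (mulI E) G q v (b 1) (mulI E (b 0))
          + t' q * dFund (mulI E) G q v (b 1) (mulI E (mulI E (b 0)))
          + s' q * (dFund (mulI E) G q v (b 0) (mulI E (b 1))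
            + s' q * dFund (mulI E) G q v (b 0) (mulI E (b 0))
            + t' q * dFund (mulI E) G q v (b 0) (mulI E (mulI E (b 0))))
          + t' q * (dFund (mulI E) G q v (mulI E (b 0)) (mulI E (b 1))
            + s' q * dFund (mulI E) G q v (mulI E (b 0)) (mulI E (b 0))
            + t' q * dFund (mulI E) G q v (mulI E (b 0)) (mulI E (mulI E (b 0)))) := by
        filter_upwards [hU.mem_nhds hp] with q hq
        have h := halt q hq
        have hyq : y q = b 1 + s' q • b 0 + t' q • mulI E (b 0) := by
          simp only [y, s', t']; module
        simp only [hyq, map_add, map_smul, h.add_mid, h.add_right, h.smul_mid, h.smul_right]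
        ring
      refine ContDiffAt.congr_of_eventuallyEq ?_ e
      exact ((((hd _ _ _).add (hs'.mul (hd _ _ _))).add (ht'.mul (hd _ _ _))).add
        (hs'.mul (((hd _ _ _).add (hs'.mul (hd _ _ _))).add (ht'.mul (hd _ _ _))))).add
        (ht'.mul (((hd _ _ _).add (hs'.mul (hd _ _ _))).add (ht'.mul (hd _ _ _))))
    refine ContDiffAt.congr_of_eventuallyEq (f := fun q =>
      lefschetz (G q) (dFund (mulI E) G q) (b 0) (y q) v) ?_ ?_
    · exact (((hd _ _ _).div (hg _ _) (ha p hp)).add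
        (hyd.div ((hGp.clm_apply hy).clm_apply hy) hyy)).neg
    · filter_upwards [hU.mem_nhds hp] with q hq using hΘ q hq v
  · obtain ⟨b', h0, h1⟩ := exists_basis_pair b (s p) (t p)
    have H := hH p hp
    have := H.eq_wedgeFund_lefschetz (halt p hp) b' (by
      rw [h0, h1]
      simp only [map_sub, map_smul, H.symm (b 0) (mulI E (b 0)), H.self, s, smul_eq_mul]
      field_simp [ha p hp]; ring) (by
      rw [h0, h1]; simp only [map_sub, map_smul, H.inv, H.self, t, smul_eq_mul]
      field_simp [ha p hp]; ring) u v w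
    rw [this]
    have e : lefschetz (G p) (dFund (mulI E) G p) (b' 0) (b' 1) = Θ p := by
      funext v; rw [hΘ p hp, h0, h1]
    rw [e]

end lefschetz

end

/-! ### Uniqueness of the Lee form and gluing over the charts. -/

section

variable {E : Type*} [NormedAddCommGroup E] [NormedSpace ℂ E] [FiniteDimensional ℂ E]

lemma IsHermitianForm.exists_orthogonal_basis {B : E →L[ℝ] E →L[ℝ] ℝ}
    (H : IsHermitianForm (mulI E) B) (b : Module.Basis (Fin 2) ℂ E) :
    ∃ b' : Module.Basis (Fin 2) ℂ E, B (b' 0) (b' 1) = 0 ∧ B (mulI E (b' 0)) (b' 1) = 0 := by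
  obtain ⟨s, t, h1, h2⟩ := H.exists_orthogonal (d := b 1) (b.ne_zero 0)
  obtain ⟨b', h3, h4⟩ := exists_basis_pair b s t
  exact ⟨b', by rw [h3, h4, h1], by rw [h3, h4, h2]⟩

/-- Injectivity in the Lefschetz isomorphism: if `w` is orthogonal to `v` and `iv`, then `θ ∧ ω` on
`(v, w, iw)` is `-θ(v) B(w,w)`. Each frame vector has such a `w`. -/
lemma IsHermitianForm.eq_zero_of_wedgeFund {B : E →L[ℝ] E →L[ℝ] ℝ}
    (H : IsHermitianForm (mulI E) B) (b : Module.Basis (Fin 2) ℂ E) {θ : E →L[ℝ] ℝ}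
    (h : ∀ u v w, wedgeFund (mulI E) B θ u v w = 0) : θ = 0 := by
  obtain ⟨b', h1, h2⟩ := H.exists_orthogonal_basis b
  have hjj := H.jj
  have key : ∀ v w, w ≠ 0 → B v w = 0 → B (mulI E v) w = 0 → θ v = 0 := by
    intro v w hw h1 h2
    have := h v w (mulI E w)
    rw [wedgeFund, hjj, H.inv, H.symm w v, h1, H.right, h2, map_neg] at this
    simpa [(H.pos w hw).ne'] using this
  have h3 : B (b' 0) (mulI E (b' 1)) = 0 := by rw [H.right, h2, neg_zero]
  have t0 : θ (b' 0) = 0 := key _ _ (b'.ne_zero 1) h1 h2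
  have t1 : θ (mulI E (b' 0)) = 0 := key _ _ (b'.ne_zero 1) h2
    (by rw [hjj, map_neg, _root_.neg_apply, h1, neg_zero])
  have t2 : θ (b' 1) = 0 := key _ _ (b'.ne_zero 0) (by rw [H.symm, h1]) (by rw [H.symm, h3])
  have t3 : θ (mulI E (b' 1)) = 0 := key _ _ (b'.ne_zero 0) (by rw [H.symm, h3])
    (by rw [hjj, map_neg, _root_.neg_apply, H.symm, h1, neg_zero])
  have h0 : ∀ i, θ (realBasis b' i) = 0 := by
    intro i
    rw [coe_realBasis]
    fin_cases i <;> assumption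
  have := (realBasis b').ext (f₁ := (θ : E →ₗ[ℝ] ℝ)) (f₂ := 0) (fun i => h0 i)
  ext u
  exact congr($this u)

variable {X : Type*} [TopologicalSpace X] [ChartedSpace E X] [IsManifold 𝓘(ℂ, E) ω X]
  {g : HermitianMetric E X} {θ : OneForm E X}

lemma OneForm.isSmooth_of_inChart
    (h : ∀ a, ContDiffOn ℝ ∞ (θ.inChart a) (chartAt E a).target) : θ.IsSmooth := by
  intro x
  have hx : chartAt E x x ∈ (chartAt E x).target := (chartAt E x).map_source (mem_chart_source E x)
  rw [contMDiffAt_hom_bundle]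
  refine ⟨contMDiffAt_id, ?_⟩
  have h1 : ContMDiffAt 𝓘(ℝ, E) 𝓘(ℝ, E →L[ℝ] ℝ) ∞ (θ.inChart x) (chartAt E x x) :=
    ((h x).contDiffAt ((chartAt E x).open_target.mem_nhds hx)).contMDiffAt
  have h2 := h1.comp x (contMDiffAt_of_mem_maximalAtlas (I := 𝓘(ℝ, E)) (n := ∞)
    (IsManifold.chart_mem_maximalAtlas x) (mem_chart_source E x))
  refine h2.congr_of_eventuallyEq ?_
  filter_upwards [(chartAt E x).open_source.mem_nhds (mem_chart_source E x)] with y hy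
  have e : θ.inChart x (chartAt E x y) = (θ y).comp (ofChart x y) := by
    unfold OneForm.inChart
    rw [(chartAt E x).left_inv hy]
  refine Eq.trans ?_ e.symm
  ext u
  simp [ContinuousLinearMap.inCoordinates, ofChart]

/-- The covector `β` satisfies `dω = β ∧ ω` at the point `y`. -/
def HermitianMetric.IsLeeAt (g : HermitianMetric E X) (y : X)
    (β : TangentSpace 𝓘(ℝ, E) y →L[ℝ] ℝ) : Prop :=
  ∀ V W Z : VField E X, V.SmoothAt y → W.SmoothAt y → Z.SmoothAt y →
    g.extDerivFundForm V W Z y =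
      β (V y) * g.fundForm y (W y) (Z y) + β (W y) * g.fundForm y (Z y) (V y)
        + β (Z y) * g.fundForm y (V y) (W y)

section
variable {a : X} {p : E} (hp : p ∈ (chartAt E a).target)
include hp

lemma HermitianMetric.isLeeAt_iff (g : HermitianMetric E X)
    (β : TangentSpace 𝓘(ℝ, E) ((chartAt E a).symm p) →L[ℝ] ℝ) :
    g.IsLeeAt ((chartAt E a).symm p) β ↔ ∀ u v w, dFund (mulI E) (g.inChart a) p u v w =
      wedgeFund (mulI E) (g.inChart a p)
        (β.comp (ofChart a ((chartAt E a).symm p))) u v w := by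
  have hy := symm_mem_source hp
  have hf : ∀ v w : TangentSpace 𝓘(ℝ, E) ((chartAt E a).symm p),
      g.fundForm ((chartAt E a).symm p) v w =
        g.inChart a p (toChart a _ v) (mulI E (toChart a _ w)) := fun v w => by
    rw [HermitianMetric.inChart_apply, ofChart_mulI hy, ofChart_toChart hy, ofChart_toChart hy]
    rfl
  have hb : ∀ v, β.comp (ofChart a ((chartAt E a).symm p)) (toChart a _ v) = β v := fun v => by
    rw [ContinuousLinearMap.comp_apply, ofChart_toChart hy]
  constructor
  · intro h u v w
    have hs := fun u : E => smoothAt_coordField (X := X) hp (f := fun _ => u) contDiffAt_const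
    have h1 := h _ _ _ (hs u) (hs v) (hs w)
    rw [g.extDerivFundForm_eq hp (hs u) (hs v) (hs w), components_coordField hp,
      components_coordField hp, components_coordField hp] at h1
    rw [h1]
    simp only [hf, coordField_const_apply, toChart_ofChart hy]
    rfl
  · intro h V W Z hV hW hZ
    rw [g.extDerivFundForm_eq hp hV hW hZ, h]
    simp only [wedgeFund, components, hf, hb]

lemma HermitianMetric.IsLeeAt.unique (b : Module.Basis (Fin 2) ℂ E)
    {β β' : TangentSpace 𝓘(ℝ, E) ((chartAt E a).symm p) →L[ℝ] ℝ}
    (h : g.IsLeeAt ((chartAt E a).symm p) β) (h' : g.IsLeeAt ((chartAt E a).symm p) β') :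
    β = β' := by
  have hy := symm_mem_source hp
  rw [g.isLeeAt_iff hp] at h h'
  have := (g.isHermitianForm_inChart hp).eq_zero_of_wedgeFund b
    (θ := (β - β').comp (ofChart a ((chartAt E a).symm p))) (fun u v w => by
      have := (h u v w).symm.trans (h' u v w)
      simp only [wedgeFund, ContinuousLinearMap.comp_apply, _root_.sub_apply] at this ⊢
      linarith)
  ext v
  have h3 := congr($this (toChart a _ v))
  rw [ContinuousLinearMap.comp_apply, ofChart_toChart hy] at h3
  exact sub_eq_zero.1 h3

end

/-- A Hermitian metric on a complex surface has a Lee form. -/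
theorem HermitianMetric.exists_isLeeFormOfSurface (g : HermitianMetric E X)
    (b : Module.Basis (Fin 2) ℂ E) : ∃ θ : OneForm E X, g.IsLeeFormOfSurface θ := by
  choose Θ hΘ hL using fun a : X => exists_local_lee (chartAt E a).open_target
    (g.contDiffOn_inChart a) (fun p hp => g.isHermitianForm_inChart hp) b
  have key : ∀ a : X, ∀ p ∈ (chartAt E a).target, g.IsLeeAt ((chartAt E a).symm p)
      ((Θ a p).comp (toChart a ((chartAt E a).symm p))) := by
    intro a p hp
    rw [g.isLeeAt_iff hp]
    have : ((Θ a p).comp (toChart a ((chartAt E a).symm p))).comp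
        (ofChart a ((chartAt E a).symm p)) = Θ a p := by
      ext u
      simp [toChart_ofChart (symm_mem_source hp)]
    rw [this]
    exact hL a p hp
  have hex : ∀ y : X, ∃ β, g.IsLeeAt y β := fun y => by
    have hy := (chartAt E y).map_source (mem_chart_source E y)
    have := key y _ hy
    rw [(chartAt E y).left_inv (mem_chart_source E y)] at this
    exact ⟨_, this⟩
  choose α hα using hex
  -- By pointwise uniqueness the chosen covectors agree in every chart with the smooth local
  -- solution, and so inherit its smoothness.
  have hin : ∀ a : X, ∀ p ∈ (chartAt E a).target, OneForm.inChart α a p = Θ a p := by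
    intro a p hp
    unfold OneForm.inChart
    rw [HermitianMetric.IsLeeAt.unique hp b (hα _) (key a p hp)]
    ext u
    simp [toChart_ofChart (symm_mem_source hp)]
  exact ⟨α, OneForm.isSmooth_of_inChart fun a => (hΘ a).congr (hin a),
    fun x V W Z hV hW hZ => hα x V W Z hV hW hZ⟩

end

/-! ### Top-degree forms under holomorphic changes of chart. -/

section

open Filter Topology MeasureTheory


section wedgeAlternating
variable {F : Type*} [NormedAddCommGroup F] [NormedSpace ℝ F]

lemma wedge_eq_zero {A B : F →L[ℝ] F →L[ℝ] ℝ} (hA : ∀ u, A u u = 0) (hB : ∀ u, B u u = 0) :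
    (∀ a b c, wedge (fun u w => A u w) (fun u w => B u w) a a b c = 0) ∧
    (∀ a b c, wedge (fun u w => A u w) (fun u w => B u w) a b a c = 0) ∧
    (∀ a b c, wedge (fun u w => A u w) (fun u w => B u w) a b c a = 0) ∧
    (∀ a b c, wedge (fun u w => A u w) (fun u w => B u w) b a a c = 0) ∧
    (∀ a b c, wedge (fun u w => A u w) (fun u w => B u w) b a c a = 0) ∧
    (∀ a b c, wedge (fun u w => A u w) (fun u w => B u w) b c a a = 0) := by
  have sA : ∀ u w, A u w = -A w u := fun u w => by
    have := hA (u + w); simp [hA] at this; linarith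
  have sB : ∀ u w, B u w = -B w u := fun u w => by
    have := hB (u + w); simp [hB] at this; linarith
  refine ⟨?_, ?_, ?_, ?_, ?_, ?_⟩ <;> intro a b c <;>
    simp only [wedge, hA, hB, sA b a, sB b a, sA c a, sB c a, sA c b, sB c b] <;> ring

/-- The wedge product of two alternating bilinear forms as an alternating map. -/
def wedgeAlternating (A B : F →L[ℝ] F →L[ℝ] ℝ) (hA : ∀ u, A u u = 0) (hB : ∀ u, B u u = 0) :
    F [⋀^Fin 4]→ₗ[ℝ] ℝ where
  toFun v := wedge (fun u w => A u w) (fun u w => B u w) (v 0) (v 1) (v 2) (v 3)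
  map_update_add' {_} m i x y := by
    have e : ‹DecidableEq (Fin 4)› = instDecidableEqFin 4 := Subsingleton.elim _ _
    subst e
    fin_cases i <;> simp [wedge, Function.update] <;> ring
  map_update_smul' {_} m i c x := by
    have e : ‹DecidableEq (Fin 4)› = instDecidableEqFin 4 := Subsingleton.elim _ _
    subst e
    fin_cases i <;> simp [wedge, Function.update] <;> ring
  map_eq_zero_of_eq' v i l hil hne := by
    obtain ⟨h1, h2, h3, h4, h5, h6⟩ := wedge_eq_zero hA hB
    fin_cases i <;> fin_cases l <;>
      simp only [Fin.zero_eta, Fin.mk_one, Fin.reduceFinMk, ne_eq, not_true_eq_false] at hil hne ⊢ <;>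
      simp only [hil, h1, h2, h3, h4, h5, h6]

end wedgeAlternating

variable {E : Type*} [NormedAddCommGroup E] [NormedSpace ℂ E]

/-- The value of the wedge product of two `2`-forms on the frame `(b₀, i b₀, b₁, i b₁)`. -/
def wedgeFrame (b : Module.Basis (Fin 2) ℂ E) (A B : E → E → ℝ) : ℝ :=
  wedge A B (b 0) (mulI E (b 0)) (b 1) (mulI E (b 1))

/-- An alternating `4`-form on a real `4`-dimensional space is a multiple of the determinant, hence
pullback by `L` multiplies it by `det L`. -/
lemma wedgeFrame_comp (b : Module.Basis (Fin 2) ℂ E) {A B : E →L[ℝ] E →L[ℝ] ℝ}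
    (hA : ∀ u, A u u = 0) (hB : ∀ u, B u u = 0) (L : E →L[ℝ] E) :
    wedgeFrame b (fun u v => A (L u) (L v)) (fun u v => B (L u) (L v)) =
      L.det * wedgeFrame b (fun u v => A u v) (fun u v => B u v) := by
  have h1 := congr($((wedgeAlternating A B hA hB).eq_smul_basis_det (realBasis b))
    (L ∘ realBasis b))
  have h2 := (realBasis b).det_comp (L : E →ₗ[ℝ] E) (realBasis b)
  rw [(realBasis b).det_self, mul_one] at h2
  rw [AlternatingMap.smul_apply, smul_eq_mul] at h1
  have h3 : (realBasis b).det (L ∘ realBasis b) = L.det := h2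
  rw [h3] at h1
  have h4 : ∀ v, wedgeAlternating A B hA hB v = wedge (fun u w => A u w) (fun u w => B u w)
    (v 0) (v 1) (v 2) (v 3) := fun _ => rfl
  rw [h4, h4] at h1
  simp only [Function.comp_apply, coe_realBasis] at h1
  rw [mul_comm]
  exact h1

/-- The real determinant of a complex linear map is the squared modulus of its complex determinant.
-/
lemma det_pos_of_commute [FiniteDimensional ℂ E] {L : E →L[ℝ] E} (hL : ∀ v, L (Complex.I • v) = Complex.I • L v)
    (hinj : Function.Injective L) : 0 < L.det := by
  let L' : E →ₗ[ℂ] E :=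
    { toFun := L
      map_add' := map_add L
      map_smul' := fun c v => by
        have h : ∀ (c : ℂ) (w : E), c • w = c.re • w + c.im • Complex.I • w := fun c w => by
          conv_lhs => rw [← Complex.re_add_im c, add_smul, mul_smul]
          rfl
        simp only [RingHom.id_apply]
        rw [h c v, h c (L v), map_add, map_smul, map_smul, hL] }
  have h1 : L.det = LinearMap.det (L'.restrictScalars ℝ) := rfl
  rw [h1, LinearMap.det_restrictScalars, Algebra.norm_complex_apply]
  refine Complex.normSq_pos.2 ?_
  intro h0
  have := LinearMap.bot_lt_ker_of_det_eq_zero h0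
  rw [LinearMap.ker_eq_bot.2 (show Function.Injective L' from hinj)] at this
  exact lt_irrefl _ this

section transition

variable [FiniteDimensional ℂ E] {X : Type*} [TopologicalSpace X] [ChartedSpace E X]
  [IsManifold 𝓘(ℂ, E) ω X] {a b : X} {p : E}
  (hp : p ∈ ((chartAt E a).symm.trans (chartAt E b)).source)
include hp

lemma contDiffAt_transition : ContDiffAt ℝ ∞ (chartAt E b ∘ (chartAt E a).symm) p := by
  have h := (contDiffGroupoid ∞ 𝓘(ℝ, E)).compatible (chart_mem_atlas E a) (chart_mem_atlas E b)
  rw [contDiffGroupoid, mem_groupoid_of_pregroupoid] at h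
  have h1 : ContDiffOn ℝ ∞ (chartAt E b ∘ (chartAt E a).symm)
    ((chartAt E a).symm.trans (chartAt E b)).source := by
    simpa [contDiffPregroupoid, mfld_simps] using h.1
  exact h1.contDiffAt (((chartAt E a).symm.trans (chartAt E b)).open_source.mem_nhds hp)

lemma toChart_ofChart_eq_fderiv (u : E) :
    toChart b ((chartAt E a).symm p) (ofChart a ((chartAt E a).symm p) u) =
      fderiv ℝ (chartAt E b ∘ (chartAt E a).symm) p u := by
  have hpt : p ∈ (chartAt E a).target := hp.1
  have hb : (chartAt E a).symm p ∈ (chartAt E b).source := hp.2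
  have h1 := toChart_eq_mfderiv (E := E) hb
  have h2 := ofChart_eq_mfderiv (E := E) hpt
  have h3 : MDifferentiableAt 𝓘(ℝ, E) 𝓘(ℝ, E) (extChartAt 𝓘(ℝ, E) b) ((chartAt E a).symm p) :=
    mdifferentiableAt_atlas (chart_mem_atlas E b) hb
  have h4 := mfderiv_comp p h3
    (mdifferentiableAt_atlas_symm (I := 𝓘(ℝ, E)) (chart_mem_atlas E a) hpt)
  have h5 : @Eq (E →L[ℝ] E) (fderiv ℝ (chartAt E b ∘ (chartAt E a).symm) p)
      ((mfderiv 𝓘(ℝ, E) 𝓘(ℝ, E) (extChartAt 𝓘(ℝ, E) b) ((chartAt E a).symm p)).comp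
        (mfderiv 𝓘(ℝ, E) 𝓘(ℝ, E) (chartAt E a).symm p)) := mfderiv_eq_fderiv.symm.trans h4
  refine Eq.trans ?_ (congrArg (fun L : E →L[ℝ] E => L u) h5).symm
  have h6 := congrArg (fun L : E →L[ℝ] E => L u) h2
  have h7 := congrArg (fun L : E →L[ℝ] E => L (ofChart a ((chartAt E a).symm p) u)) h1
  refine h7.trans ?_
  exact congrArg (fun w : E => (mfderiv 𝓘(ℝ, E) 𝓘(ℝ, E) (extChartAt 𝓘(ℝ, E) b)
    ((chartAt E a).symm p) : E →L[ℝ] E) w) h6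

lemma det_transition_pos : 0 < (fderiv ℝ (chartAt E b ∘ (chartAt E a).symm) p).det := by
  refine det_pos_of_commute (fderiv_transition_smul_I hp) fun u v huv => ?_
  have hy : (chartAt E a).symm p ∈ (chartAt E a).source := symm_mem_source hp.1
  have hb : (chartAt E a).symm p ∈ (chartAt E b).source := hp.2
  rw [← toChart_ofChart_eq_fderiv hp, ← toChart_ofChart_eq_fderiv hp] at huv
  have h1 := congrArg (ofChart b ((chartAt E a).symm p)) huv
  rw [ofChart_toChart hb, ofChart_toChart hb] at h1
  rw [← toChart_ofChart hy u, h1, toChart_ofChart hy]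

lemma dOne_inChart_transition {θ : OneForm E X} (h : θ.IsSmooth) (u v : E) :
    dOne (θ.inChart a) p u v =
      dOne (θ.inChart b) (chartAt E b ((chartAt E a).symm p))
        (fderiv ℝ (chartAt E b ∘ (chartAt E a).symm) p u)
        (fderiv ℝ (chartAt E b ∘ (chartAt E a).symm) p v) := by
  have hs := fun u : E => smoothAt_coordField (X := X) hp.1 (f := fun _ => u) contDiffAt_const
  have h1 := OneForm.extDeriv_eq hp.1 h (hs u) (hs v)
  rw [components_coordField hp.1, components_coordField hp.1] at h1
  have hq : chartAt E b ((chartAt E a).symm p) ∈ (chartAt E b).target :=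
    (chartAt E b).map_source hp.2
  have hinv : (chartAt E b).symm (chartAt E b ((chartAt E a).symm p)) = (chartAt E a).symm p :=
    (chartAt E b).left_inv hp.2
  have h2 := OneForm.extDeriv_eq (V := coordField a fun _ => u) (W := coordField a fun _ => v) hq h
    (by rw [hinv]; exact hs u) (by rw [hinv]; exact hs v)
  have hc : ∀ u, components b (coordField (X := X) a fun _ => u)
      (chartAt E b ((chartAt E a).symm p)) =
        fderiv ℝ (chartAt E b ∘ (chartAt E a).symm) p u := fun u => by
    rw [← toChart_ofChart_eq_fderiv hp, components, hinv]
    rfl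
  rw [hc, hc, hinv] at h2
  rw [← h1, h2]

lemma wedgeFrame_transition (f : Module.Basis (Fin 2) ℂ E) {α θ : OneForm E X} (hα : α.IsSmooth)
    (hθ : θ.IsSmooth) :
    wedgeFrame f (dOne (α.inChart a) p) (dOne (θ.inChart a) p) =
      (fderiv ℝ (chartAt E b ∘ (chartAt E a).symm) p).det *
        wedgeFrame f (dOne (α.inChart b) (chartAt E b ((chartAt E a).symm p)))
          (dOne (θ.inChart b) (chartAt E b ((chartAt E a).symm p))) := by
  have h := wedgeFrame_comp f
    (A := fderiv ℝ (α.inChart b) (chartAt E b ((chartAt E a).symm p)) -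
      (fderiv ℝ (α.inChart b) (chartAt E b ((chartAt E a).symm p))).flip)
    (B := fderiv ℝ (θ.inChart b) (chartAt E b ((chartAt E a).symm p)) -
      (fderiv ℝ (θ.inChart b) (chartAt E b ((chartAt E a).symm p))).flip)
    (fun u => by simp) (fun u => by simp) (fderiv ℝ (chartAt E b ∘ (chartAt E a).symm) p)
  refine Eq.trans ?_ h
  congr 1
  · funext u v; exact dOne_inChart_transition hp hα u v
  · funext u v; exact dOne_inChart_transition hp hθ u v

end transition

end

/-! ### Stokes' theorem for compactly supported forms on an open set. -/

section

open Filter Topology MeasureTheory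


section stokes

variable {F : Type*} [NormedAddCommGroup F] [NormedSpace ℝ F] [FiniteDimensional ℝ F]
  [MeasurableSpace F] [BorelSpace F] {μ : Measure F} [μ.IsAddHaarMeasure]
  {U K : Set F}

/-- Integration by parts against the constant function `1`. -/
lemma integral_fderiv_eq_zero {ψ : F → ℝ} (hψ : ContDiff ℝ 1 ψ) (hc : HasCompactSupport ψ) (v : F) :
    ∫ p, fderiv ℝ ψ p v ∂μ = 0 := by
  have hi : Integrable (fun p => fderiv ℝ ψ p v) μ :=
    ((hψ.continuous_fderiv (by simp)).clm_apply continuous_const).integrable_of_hasCompactSupport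
      ((hc.fderiv (𝕜 := ℝ)).comp_left (g := fun L : F →L[ℝ] ℝ => L v) (by simp))
  have := integral_mul_fderiv_eq_neg_fderiv_mul_of_integrable (μ := μ) (f := fun _ : F => (1 : ℝ))
    (g := ψ) (v := v) (by simp) (by simpa using hi)
    (by simpa using hψ.continuous.integrable_of_hasCompactSupport hc)
    (fun x _ => differentiableAt_const _) (fun x _ => hψ.differentiable (by simp) x)
  simpa using this

variable (hU : IsOpen U) (hK : IsCompact K) (hKU : K ⊆ U)
include hU hK hKU

/-- As `φ` vanishes on `U` off the compact set `K`, its extension by zero is `C¹` on the whole space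
with compact support. -/
lemma setIntegral_fderiv_eq_zero {φ : F → ℝ} (hφ : ContDiffOn ℝ 1 φ U)
    (h0 : ∀ p ∈ U, p ∉ K → φ p = 0) (v : F) : ∫ p in U, fderiv ℝ φ p v ∂μ = 0 := by
  classical
  have hz : ∀ p, p ∉ K → U.indicator φ p = 0 := fun p hp => by
    by_cases hpU : p ∈ U
    · rw [Set.indicator_of_mem hpU, h0 p hpU hp]
    · rw [Set.indicator_of_notMem hpU]
  have hin : ∀ p ∈ U, U.indicator φ =ᶠ[𝓝 p] φ := fun p hp => by
    filter_upwards [hU.mem_nhds hp] with q hq using Set.indicator_of_mem hq φ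
  have hout : ∀ p ∉ K, U.indicator φ =ᶠ[𝓝 p] fun _ => 0 := fun p hp => by
    filter_upwards [hK.isClosed.isOpen_compl.mem_nhds hp] with q hq using hz q hq
  have hs : ContDiff ℝ 1 (U.indicator φ) := contDiff_iff_contDiffAt.2 fun p => by
    by_cases hp : p ∈ K
    · exact (hφ.contDiffAt (hU.mem_nhds (hKU hp))).congr_of_eventuallyEq (hin p (hKU hp))
    · exact contDiffAt_const.congr_of_eventuallyEq (hout p hp)
  have hc : HasCompactSupport (U.indicator φ) := HasCompactSupport.intro hK hz
  rw [← integral_fderiv_eq_zero (μ := μ) hs hc v]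
  rw [setIntegral_congr_fun (g := fun p => fderiv ℝ (U.indicator φ) p v) hU.measurableSet
    (fun p hp => by simp only [(hin p hp).fderiv_eq])]
  refine setIntegral_eq_integral_of_forall_compl_eq_zero fun p hp => ?_
  have hpK : p ∉ K := fun h => hp (hKU h)
  simp [(hout p hpK).fderiv_eq]

lemma integrableOn_of_continuousOn_of_eq_zero {φ : F → ℝ} (hφ : ContinuousOn φ U)
    (h0 : ∀ p ∈ U, p ∉ K → φ p = 0) : IntegrableOn φ U μ := by
  have h1 : IntegrableOn φ K μ := (hφ.mono hKU).integrableOn_compact hK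
  exact h1.of_forall_sdiff_eq_zero hU.measurableSet fun p hp => h0 p hp.1 hp.2

variable {α θ : F → F →L[ℝ] ℝ} (hα : ContDiffOn ℝ ∞ α U) (hθ : ContDiffOn ℝ ∞ θ U)
  (h0 : ∀ p ∈ U, p ∉ K → α p = 0)

omit [FiniteDimensional ℝ F] [MeasurableSpace F] [BorelSpace F] hK hKU in
lemma contDiffOn_dOne (hθ : ContDiffOn ℝ ∞ θ U) (u v : F) :
    ContDiffOn ℝ ∞ (fun p => dOne θ p u v) U := by
  have h1 := hθ.fderiv_of_isOpen hU (m := ∞) (by simp)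
  exact ((h1.clm_apply contDiffOn_const).clm_apply contDiffOn_const).sub
    ((h1.clm_apply contDiffOn_const).clm_apply contDiffOn_const)

omit [FiniteDimensional ℝ F] [MeasurableSpace F] [BorelSpace F] hK hKU in
/-- `d(dθ) = 0`. -/
lemma fderiv_dOne_cyclic (hθ : ContDiffOn ℝ ∞ θ U) {p : F} (hp : p ∈ U) (u v w : F) :
    fderiv ℝ (fun q => dOne θ q v w) p u + fderiv ℝ (fun q => dOne θ q w u) p v +
      fderiv ℝ (fun q => dOne θ q u v) p w = 0 := by
  have hs : ∀ u v : F, fderiv ℝ (fderiv ℝ θ) p u v = fderiv ℝ (fderiv ℝ θ) p v u :=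
    (hθ.contDiffAt (hU.mem_nhds hp)).isSymmSndFDerivAt (by
      simp only [minSmoothness_of_isRCLikeNormedField]
      exact WithTop.coe_le_coe.2 (le_top : (2 : ℕ∞) ≤ ⊤))
  have hd := (((hθ.fderiv_of_isOpen hU (m := ∞) (by simp)).contDiffAt
    (hU.mem_nhds hp)).differentiableAt (by simp)).hasFDerivAt
  have key : ∀ u v w, fderiv ℝ (fun q => dOne θ q v w) p u =
      fderiv ℝ (fderiv ℝ θ) p u v w - fderiv ℝ (fderiv ℝ θ) p u w v := by
    intro u v w
    have h1 : HasFDerivAt (fun q => dOne θ q v w) _ p :=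
      ((hd.clm_apply (hasFDerivAt_const v p)).clm_apply (hasFDerivAt_const w p)).sub
        ((hd.clm_apply (hasFDerivAt_const w p)).clm_apply (hasFDerivAt_const v p))
    rw [h1.fderiv]
    simp
  rw [key, key, key, hs v u, hs w u, hs w v]
  ring

include hα hθ h0

/-- Stokes' theorem for `d(α ∧ dθ)`. -/
lemma setIntegral_wedge_dOne_eq_zero (a b c d : F) :
    ∫ p in U, wedge (dOne α p) (dOne θ p) a b c d ∂μ = 0 := by
  have hf : ∀ s v w, ContDiffOn ℝ 1 (fun p => α p s * dOne θ p v w) U := fun s v w =>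
    ((hα.clm_apply contDiffOn_const).mul (contDiffOn_dOne hU hθ v w)).of_le
      (by exact_mod_cast le_top)
  have hz : ∀ s v w, ∀ p ∈ U, p ∉ K → α p s * dOne θ p v w = 0 := fun s v w p hp hpK => by
    simp [h0 p hp hpK]
  have hT : ∀ u s v w,
      IntegrableOn (fun p => fderiv ℝ (fun p => α p s * dOne θ p v w) p u) U μ ∧
      ∫ p in U, fderiv ℝ (fun p => α p s * dOne θ p v w) p u ∂μ = 0 := fun u s v w => by
    refine ⟨integrableOn_of_continuousOn_of_eq_zero hU hK hKU
      (((hf s v w).continuousOn_fderiv_of_isOpen hU (by simp)).clm_apply continuousOn_const) ?_,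
      setIntegral_fderiv_eq_zero hU hK hKU (hf s v w) (hz s v w) u⟩
    intro p hp hpK
    have : (fun p => α p s * dOne θ p v w) =ᶠ[𝓝 p] fun _ => 0 := by
      filter_upwards [hU.mem_nhds hp, hK.isClosed.isOpen_compl.mem_nhds hpK] with q hq hqK
        using hz s v w q hq hqK
    simp [this.fderiv_eq]
  have hsub : ∀ {f g : F → ℝ}, (IntegrableOn f U μ ∧ ∫ p in U, f p ∂μ = 0) →
      (IntegrableOn g U μ ∧ ∫ p in U, g p ∂μ = 0) →
      (IntegrableOn (fun p => f p - g p) U μ ∧ ∫ p in U, (f p - g p) ∂μ = 0) :=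
    fun hf hg => ⟨hf.1.sub hg.1, by rw [integral_sub hf.1 hg.1, hf.2, hg.2, sub_zero]⟩
  have hadd : ∀ {f g : F → ℝ}, (IntegrableOn f U μ ∧ ∫ p in U, f p ∂μ = 0) →
      (IntegrableOn g U μ ∧ ∫ p in U, g p ∂μ = 0) →
      (IntegrableOn (fun p => f p + g p) U μ ∧ ∫ p in U, (f p + g p) ∂μ = 0) :=
    fun hf hg => ⟨hf.1.add hg.1, by rw [integral_add hf.1 hg.1, hf.2, hg.2, add_zero]⟩
  have hP : ∀ u s v w, (IntegrableOn (fun p => fderiv ℝ (fun p => α p s * dOne θ p v w) p u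
      - fderiv ℝ (fun p => α p u * dOne θ p v w) p s) U μ ∧ ∫ p in U,
      (fderiv ℝ (fun p => α p s * dOne θ p v w) p u
      - fderiv ℝ (fun p => α p u * dOne θ p v w) p s) ∂μ = 0) := fun u s v w =>
    hsub (hT u s v w) (hT s u v w)
  -- This sum of derivatives has zero integral and differs from `dα ∧ dθ` only by terms of `α ∧
  -- d(dθ)`, which vanish by `c1` to `c4` below.
  have := (hadd (hsub (hadd (hadd (hsub (hP a b c d) (hP a c b d)) (hP a d b c)) (hP b c a d))
    (hP b d a c)) (hP c d a b)).2
  rw [← this]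
  refine setIntegral_congr_fun hU.measurableSet fun p hp => ?_
  have hD : ∀ u s v w, fderiv ℝ (fun p => α p s * dOne θ p v w) p u =
      fderiv ℝ α p u s * dOne θ p v w + α p s * fderiv ℝ (fun q => dOne θ q v w) p u := by
    intro u s v w
    have h1 : HasFDerivAt (fun q => α q s) _ p :=
      ((hα.contDiffAt (hU.mem_nhds hp)).differentiableAt (by simp)).hasFDerivAt.clm_apply
        (hasFDerivAt_const s p)
    have h2 := (((contDiffOn_dOne hU hθ v w).contDiffAt (hU.mem_nhds hp)).differentiableAt
      (by simp)).hasFDerivAt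
    have h3 : HasFDerivAt (fun p => α p s * dOne θ p v w) _ p := h1.mul h2
    rw [h3.fderiv]
    simp
    ring
  have hsw : ∀ u v w, fderiv ℝ (fun q => dOne θ q v w) p u =
      -fderiv ℝ (fun q => dOne θ q w v) p u := by
    intro u v w
    have : (fun q => dOne θ q v w) = fun q => -dOne θ q w v := by
      funext q; unfold dOne; ring
    rw [this, fderiv_fun_neg]
    rfl
  have c1 := fderiv_dOne_cyclic hU hθ hp b c d
  have c2 := fderiv_dOne_cyclic hU hθ hp a c d
  have c3 := fderiv_dOne_cyclic hU hθ hp a b d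
  have c4 := fderiv_dOne_cyclic hU hθ hp a b c
  rw [hsw c d b] at c1
  rw [hsw c d a] at c2
  rw [hsw b d a] at c3
  rw [hsw b c a] at c4
  simp only [hD, wedge]
  have e : ∀ u v, dOne α p u v = fderiv ℝ α p u v - fderiv ℝ α p v u := fun _ _ => rfl
  simp only [e]
  linear_combination α p a * c1 - α p b * c2 + α p c * c3 - α p d * c4

end stokes

end

/-! ### Integration over the compact surface by a partition of unity. -/

section

open Filter Topology MeasureTheory


variable {E : Type*} [NormedAddCommGroup E] [NormedSpace ℂ E] [FiniteDimensional ℂ E]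
  {X : Type*} [TopologicalSpace X] [ChartedSpace E X] [IsManifold 𝓘(ℂ, E) ω X]

section changeOfVariables

variable [MeasurableSpace E] [BorelSpace E] {μ : Measure E} [μ.IsAddHaarMeasure]

/-- The integral of a top-degree form does not depend on the chart. -/
lemma setIntegral_chart_eq {a b : X} {u v : E → ℝ}
    (huv : ∀ p ∈ ((chartAt E a).symm.trans (chartAt E b)).source,
      u p = (fderiv ℝ (chartAt E b ∘ (chartAt E a).symm) p).det *
        v (chartAt E b ((chartAt E a).symm p)))
    (hu : ∀ p ∈ (chartAt E a).target, (chartAt E a).symm p ∉ (chartAt E b).source → u p = 0)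
    (hv : ∀ p ∈ (chartAt E b).target, (chartAt E b).symm p ∉ (chartAt E a).source → v p = 0) :
    ∫ p in (chartAt E a).target, u p ∂μ = ∫ p in (chartAt E b).target, v p ∂μ := by
  have : FiniteDimensional ℝ E := FiniteDimensional.complexToReal E
  set e := (chartAt E a).symm.trans (chartAt E b) with he
  have hS : MeasurableSet e.source := e.open_source.measurableSet
  have h1 : ∫ p in (chartAt E a).target, u p ∂μ = ∫ p in e.source, u p ∂μ :=
    setIntegral_eq_of_subset_of_forall_sdiff_eq_zero (chartAt E a).open_target.measurableSet
      (fun (p : E) (hp : p ∈ e.source) => hp.1)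
      (fun p hp => hu p hp.1 fun h => hp.2 ⟨hp.1, h⟩)
  have h2 : ∫ p in (chartAt E b).target, v p ∂μ = ∫ p in e.target, v p ∂μ :=
    setIntegral_eq_of_subset_of_forall_sdiff_eq_zero (chartAt E b).open_target.measurableSet
      (fun (p : E) (hp : p ∈ e.target) => hp.1) (fun p hp => hv p hp.1 fun h => hp.2 ⟨hp.1, h⟩)
  rw [h1, h2, ← e.image_source_eq_target]
  have h3 := integral_image_eq_integral_abs_det_fderiv_smul μ hS
    (f := e) (f' := fun p => fderiv ℝ (chartAt E b ∘ (chartAt E a).symm) p)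
    (fun p hp => ((contDiffAt_transition hp).differentiableAt (by simp)).hasFDerivAt.hasFDerivWithinAt)
    e.injOn v
  rw [h3]
  refine setIntegral_congr_fun hS fun p hp => ?_
  simp only [huv p hp, abs_of_pos (det_transition_pos hp), smul_eq_mul]
  rfl

end changeOfVariables

/-- The product of a function and a one-form. -/
def OneForm.mulLeft (ρ : X → ℝ) (θ : OneForm E X) : OneForm E X := fun x => ρ x • θ x

lemma OneForm.inChart_mulLeft (ρ : X → ℝ) (θ : OneForm E X) (a : X) :
    (θ.mulLeft ρ).inChart a = fun p => ρ ((chartAt E a).symm p) • θ.inChart a p := rfl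

lemma contDiffOn_comp_chart_symm {ρ : X → ℝ} (hρ : ContMDiff 𝓘(ℝ, E) 𝓘(ℝ, ℝ) ∞ ρ) (a : X) :
    ContDiffOn ℝ ∞ (fun p => ρ ((chartAt E a).symm p)) (chartAt E a).target := fun _ hp =>
  (ContMDiffAt.comp_chart_symm hp (hρ _)).contDiffWithinAt

lemma OneForm.IsSmooth.mulLeft {ρ : X → ℝ} (hρ : ContMDiff 𝓘(ℝ, E) 𝓘(ℝ, ℝ) ∞ ρ)
    {θ : OneForm E X} (h : θ.IsSmooth) : (θ.mulLeft ρ).IsSmooth :=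
  OneForm.isSmooth_of_inChart fun a => by
    rw [OneForm.inChart_mulLeft]
    exact (contDiffOn_comp_chart_symm hρ a).smul (h.contDiffOn_inChart a)

lemma wedgeFrame_eq_zero_left (b : Module.Basis (Fin 2) ℂ E) {A B : E → E → ℝ}
    (hA : ∀ u v, A u v = 0) : wedgeFrame b A B = 0 := by
  simp [wedgeFrame, wedge, hA]

lemma wedgeFrame_sum_left (b : Module.Basis (Fin 2) ℂ E) {ι : Type*} (s : Finset ι)
    (A : ι → E → E → ℝ) (B : E → E → ℝ) :
    wedgeFrame b (fun u v => ∑ i ∈ s, A i u v) B = ∑ i ∈ s, wedgeFrame b (A i) B := by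
  simp only [wedgeFrame, wedge, Finset.sum_add_distrib, Finset.sum_sub_distrib, Finset.sum_mul]

lemma contDiffOn_wedgeFrame (b : Module.Basis (Fin 2) ℂ E) {α θ : OneForm E X} (hα : α.IsSmooth)
    (hθ : θ.IsSmooth) (a : X) : ContDiffOn ℝ ∞
      (fun p => wedgeFrame b (dOne (α.inChart a) p) (dOne (θ.inChart a) p)) (chartAt E a).target := by
  have h1 := fun u v => contDiffOn_dOne (chartAt E a).open_target (hα.contDiffOn_inChart a) u v
  have h2 := fun u v => contDiffOn_dOne (chartAt E a).open_target (hθ.contDiffOn_inChart a) u v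
  unfold wedgeFrame wedge
  exact (((((((h1 _ _).mul (h2 _ _)).sub ((h1 _ _).mul (h2 _ _))).add ((h1 _ _).mul (h2 _ _))).add
    ((h1 _ _).mul (h2 _ _))).sub ((h1 _ _).mul (h2 _ _))).add ((h1 _ _).mul (h2 _ _)))

/-- `d(ρ θ)` vanishes away from the support of `ρ`. -/
lemma dOne_mulLeft_eq_zero {ρ : X → ℝ} (θ : OneForm E X) {a : X} {p : E}
    (hp : p ∈ (chartAt E a).target) (hρ : (chartAt E a).symm p ∉ tsupport ρ) (u v : E) :
    dOne ((θ.mulLeft ρ).inChart a) p u v = 0 := by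
  have h1 : (θ.mulLeft ρ).inChart a =ᶠ[𝓝 p] fun _ => 0 := by
    have hc := ((chartAt E a).continuousAt_symm hp)
    filter_upwards [hc.preimage_mem_nhds ((isClosed_tsupport ρ).isOpen_compl.mem_nhds hρ)] with q hq
    rw [OneForm.inChart_mulLeft]
    simp only
    rw [image_eq_zero_of_notMem_tsupport hq, zero_smul]
  unfold dOne
  simp [h1.fderiv_eq]

/-- On a compact surface, a smooth one-form `θ` such that `(dθ)²` is nonpositive, and nonzero where
`dθ` is nonzero, is closed. -/
theorem OneForm.isClosed_of_wedge_nonpos [T2Space X] [CompactSpace X] {θ : OneForm E X}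
    (hθ : θ.IsSmooth) (f : Module.Basis (Fin 2) ℂ E)
    (h : ∀ (a : X), ∀ p ∈ (chartAt E a).target,
      wedgeFrame f (dOne (θ.inChart a) p) (dOne (θ.inChart a) p) ≤ 0 ∧
      (wedgeFrame f (dOne (θ.inChart a) p) (dOne (θ.inChart a) p) = 0 →
        ∀ u v, dOne (θ.inChart a) p u v = 0)) : θ.IsClosed := by
  have : FiniteDimensional ℝ E := FiniteDimensional.complexToReal E
  let _ : MeasurableSpace E := borel E
  have : BorelSpace E := ⟨rfl⟩
  let μ : Measure E := Measure.addHaar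
  obtain ⟨t, ht⟩ := isCompact_univ.elim_finite_subcover (fun a : X => (chartAt E a).source)
    (fun a => (chartAt E a).open_source)
    (fun x _ => Set.mem_iUnion.2 ⟨x, mem_chart_source E x⟩)
  obtain ⟨ρ, hρ⟩ := SmoothPartitionOfUnity.exists_isSubordinate 𝓘(ℝ, E) isClosed_univ
    (fun i : t => (chartAt E (i : X)).source) (fun i => (chartAt E (i : X)).open_source)
    (fun x hx => by simpa using ht hx)
  have hsum : ∀ x, ∑ i, ρ i x = 1 := fun x => by
    rw [← finsum_eq_sum_of_fintype]; exact ρ.sum_eq_one (Set.mem_univ x)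
  have hsmooth : ∀ i, ContMDiff 𝓘(ℝ, E) 𝓘(ℝ, ℝ) ∞ (ρ i) := fun i => (ρ i).contMDiff
  let U : t → Set E := fun i => (chartAt E (i : X)).target
  let K : t → Set E := fun i => chartAt E (i : X) '' tsupport (ρ i)
  have hU : ∀ i, IsOpen (U i) := fun i => (chartAt E (i : X)).open_target
  have hK : ∀ i, IsCompact (K i) := fun i => (isClosed_tsupport _).isCompact.image_of_continuousOn
    ((chartAt E (i : X)).continuousOn.mono (hρ i))
  have hKU : ∀ i, K i ⊆ U i := fun i => by
    rintro _ ⟨x, hx, rfl⟩; exact (chartAt E (i : X)).map_source (hρ i hx)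
  have hnot : ∀ i, ∀ p ∈ U i, p ∉ K i → (chartAt E (i : X)).symm p ∉ tsupport (ρ i) :=
    fun i p hp hpK hs => hpK ⟨_, hs, (chartAt E (i : X)).right_inv hp⟩
  have hzero : ∀ i, ∀ x ∉ tsupport (ρ i), ρ i x = 0 := fun i x hx =>
    image_eq_zero_of_notMem_tsupport hx
  -- the density of `ρᵢ d(ρₖ θ) ∧ dθ` in the chart `l`
  let w : t → t → t → E → ℝ := fun l i k p => ρ i ((chartAt E (l : X)).symm p) *
    wedgeFrame f (dOne ((θ.mulLeft (ρ k)).inChart l) p) (dOne (θ.inChart l) p)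
  have hw : ∀ l i k, ContinuousOn (w l i k) (U l) := fun l i k =>
    ((contDiffOn_comp_chart_symm (hsmooth i) _).mul
      (contDiffOn_wedgeFrame f (hθ.mulLeft (hsmooth k)) hθ l)).continuousOn
  -- In chart `k` the factor `ρ k` confines the integrand to a compact set; in chart `i` (`hint'`)
  -- the factor `ρ i` does.
  have hint : ∀ i k, IntegrableOn (w k i k) (U k) μ := fun i k =>
    integrableOn_of_continuousOn_of_eq_zero (hU k) (hK k) (hKU k) (hw k i k) fun p hp hpK => by
      simp only [w]
      rw [wedgeFrame_eq_zero_left f (dOne_mulLeft_eq_zero θ hp (hnot k p hp hpK)), mul_zero]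
  have hint' : ∀ i k, IntegrableOn (w i i k) (U i) μ := fun i k =>
    integrableOn_of_continuousOn_of_eq_zero (hU i) (hK i) (hKU i) (hw i i k) fun p hp hpK => by
      simp only [w]
      rw [hzero i _ (hnot i p hp hpK), zero_mul]
  -- Summing over `i` removes `ρ i` and leaves the exact form `d(ρ_k θ) ∧ dθ`.
  have hstokes : ∀ k, ∑ i, ∫ p in U k, w k i k p ∂μ = 0 := fun k => by
    rw [← integral_finsetSum _ fun i _ => hint i k]
    have := setIntegral_wedge_dOne_eq_zero (μ := μ) (hU k) (hK k) (hKU k)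
      ((hθ.mulLeft (hsmooth k)).contDiffOn_inChart (k : X)) (hθ.contDiffOn_inChart (k : X))
      (fun p hp hpK => by
        rw [OneForm.inChart_mulLeft]
        simp only
        rw [hzero k _ (hnot k p hp hpK), zero_smul]) (f 0) (mulI E (f 0)) (f 1) (mulI E (f 1))
    rw [← this]
    refine setIntegral_congr_fun (hU k).measurableSet fun p hp => ?_
    simp only [w]
    rw [← Finset.sum_mul, hsum, one_mul]
    rfl
  -- Off the overlap of the two charts the integrand vanishes, through `ρ i` in chart `k` and
  -- through `ρ k` in chart `i`.
  have hchange : ∀ i k, ∫ p in U k, w k i k p ∂μ = ∫ p in U i, w i i k p ∂μ := fun i k => by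
    refine setIntegral_chart_eq (fun p hp => ?_) (fun p hp hpn => ?_) (fun p hp hpn => ?_)
    · have hpi : (chartAt E (k : X)).symm p ∈ (chartAt E (i : X)).source := hp.2
      simp only [w]
      rw [wedgeFrame_transition hp f (hθ.mulLeft (hsmooth k)) hθ,
        (chartAt E (i : X)).left_inv hpi]
      ring
    · simp only [w]
      rw [hzero i _ fun hs => hpn (hρ i hs), zero_mul]
    · simp only [w]
      rw [wedgeFrame_eq_zero_left f (dOne_mulLeft_eq_zero θ hp fun hs => hpn (hρ k hs)), mul_zero]
  let v : t → E → ℝ := fun i p => ρ i ((chartAt E (i : X)).symm p) *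
    wedgeFrame f (dOne (θ.inChart i) p) (dOne (θ.inChart i) p)
  -- In the fixed chart `i`, the forms `d(ρ_k θ)` add up to `dθ`, leaving `ρ_i dθ ∧ dθ`.
  have hv : ∀ i, ∀ p ∈ U i, ∑ k, w i i k p = v i p := fun i p hp => by
    simp only [w, v]
    rw [← Finset.mul_sum, ← wedgeFrame_sum_left]
    have hd : ∀ k, DifferentiableAt ℝ ((θ.mulLeft (ρ k)).inChart (i : X)) p := fun k =>
      (hθ.mulLeft (hsmooth k)).differentiableAt_inChart hp
    have e : θ.inChart (i : X) = fun q => ∑ k, (θ.mulLeft (ρ k)).inChart (i : X) q := by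
      funext q
      simp only [OneForm.inChart_mulLeft]
      rw [← Finset.sum_smul, hsum, one_smul]
    have e2 : dOne (θ.inChart (i : X)) p =
        fun u v => ∑ k, dOne ((θ.mulLeft (ρ k)).inChart (i : X)) p u v := by
      funext u v
      unfold dOne
      rw [e, fderiv_fun_sum fun k _ => hd k, Finset.sum_sub_distrib]
      simp
    rw [e2]
  have htotal : ∑ i, ∫ p in U i, v i p ∂μ = 0 := by
    have h1 : ∀ i, ∫ p in U i, v i p ∂μ = ∑ k, ∫ p in U i, w i i k p ∂μ := fun i => by
      rw [← integral_finsetSum _ fun k _ => hint' i k]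
      exact setIntegral_congr_fun (hU i).measurableSet fun p hp => (hv i p hp).symm
    rw [Finset.sum_congr rfl fun i _ => h1 i, Finset.sum_comm]
    refine Finset.sum_eq_zero fun k _ => ?_
    rw [← hstokes k]
    exact Finset.sum_congr rfl fun i _ => (hchange i k).symm
  have hnonpos : ∀ i, ∀ p ∈ U i, v i p ≤ 0 := fun i p hp =>
    mul_nonpos_of_nonneg_of_nonpos (ρ.nonneg i _) (h i p hp).1
  have hvc : ∀ i, ContinuousOn (v i) (U i) := fun i =>
    ((contDiffOn_comp_chart_symm (hsmooth i) _).mul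
      (contDiffOn_wedgeFrame f hθ hθ i)).continuousOn
  have hvi : ∀ i, IntegrableOn (v i) (U i) μ := fun i =>
    integrableOn_of_continuousOn_of_eq_zero (hU i) (hK i) (hKU i) (hvc i) fun p hp hpK => by
      simp only [v]
      rw [hzero i _ (hnot i p hp hpK), zero_mul]
  have heach : ∀ i, ∫ p in U i, v i p ∂μ = 0 := fun i =>
    (Finset.sum_eq_zero_iff_of_nonpos fun i _ =>
      setIntegral_nonpos (hU i).measurableSet (hnonpos i)).1 htotal i (Finset.mem_univ i)
  -- A continuous function of constant sign with zero integral vanishes everywhere on the open set.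
  have hvzero : ∀ i, ∀ p ∈ U i, v i p = 0 := fun i => by
    have h1 : ∫ p in U i, -v i p ∂μ = 0 := by rw [integral_neg, heach, neg_zero]
    have h2 := (setIntegral_eq_zero_iff_of_nonneg_ae (ae_restrict_of_forall_mem
      (hU i).measurableSet fun p hp => neg_nonneg.2 (hnonpos i p hp)) (hvi i).neg).1 h1
    have h3 : (v i) =ᵐ[μ.restrict (U i)] fun _ => 0 := by
      filter_upwards [h2] with p hp using neg_eq_zero.1 hp
    exact Measure.eqOn_open_of_ae_eq h3 (hU i) (hvc i) continuousOn_const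
  intro x V W hV hW
  obtain ⟨i, hi⟩ : ∃ i, ρ i x ≠ 0 := by
    by_contra! h0
    have := hsum x
    simp [h0] at this
  have hxs : x ∈ (chartAt E (i : X)).source := hρ i (subset_tsupport _ hi)
  have hp := (chartAt E (i : X)).map_source hxs
  have hinv := (chartAt E (i : X)).left_inv hxs
  have h1 := hvzero i _ hp
  simp only [v, hinv, mul_eq_zero, hi, false_or] at h1
  have h2 := (h i _ hp).2 h1
  have h3 := OneForm.extDeriv_eq (V := V) (W := W) hp hθ (by rwa [hinv]) (by rwa [hinv])
  rw [hinv, h2] at h3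
  exact h3

end

end BismutSurface

end

theorem mainTheorem10 {E : Type*} [NormedAddCommGroup E] [NormedSpace ℂ E] [FiniteDimensional ℂ E]
    (hE : Module.finrank ℂ E = 2)
    {X : Type*} [TopologicalSpace X] [T2Space X] [CompactSpace X] [ChartedSpace E X]
    [IsManifold 𝓘(ℂ, E) ω X]
    (g : BismutSurface.HermitianMetric E X)
    (cov : BismutSurface.AffineConnection E X) (hcov : g.IsBismutConnection cov)
    (hR : g.CurvatureJInvariant cov) :
    (∀ θ : BismutSurface.OneForm E X, g.IsLeeFormOfSurface θ → θ.IsClosed) ∧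
      g.IsLocallyConformallyKahler := by
  have b : Module.Basis (Fin 2) ℂ E := Module.finBasisOfFinrankEq ℂ E hE
  have closed : ∀ θ : BismutSurface.OneForm E X, g.IsLeeFormOfSurface θ → θ.IsClosed :=
    fun θ hθ => BismutSurface.OneForm.isClosed_of_wedge_nonpos hθ.1 b
      fun _ _ hp => hθ.wedge_dOne_nonpos hcov hR b hp
  -- The Lee form itself serves as the closed form in the locally conformally Kähler condition.
  obtain ⟨α, hα⟩ := g.exists_isLeeFormOfSurface b
  exact ⟨closed, α, hα.1, closed α hα, hα.2⟩
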